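/- For each $n\ge 1$ let $f_n(z)=\sum_{k=0}^n a_{n,k}z^k$ be a polynomial with complex coefficients, not identically zero, and let $\mu_n=\frac1n\sum_{\zeta}\delta_\zeta$ be its empirical zero measure, the sum being over the zeros $\zeta\in\mathbf{C}$ of $f_n$ counted with multiplicity (equivalently, $\mu_n$ is the Riesz measure of $\frac1n\log|f_n|$; it is a probability measure if $\deg f_n=n$). Put $\log 0=-\infty$. Then, as $n\to\infty$, the measures $\mu_n$ converge weakly (that is, against all bounded continuous functions on $\mathbf{C}$) to the uniform probability measure on the unit circle if and only if the following condition holds. For every $\varepsilon>0$ there exists $n_\varepsilon$ such that for every $n>n_\varepsilon$, both $$\max_{0\le k\le n}\log|a_{n,k}|-\max_{k\in[0,\varepsilon n]}\log|a_{n,k}|\le\varepsilon n$$ and $$\max_{0\le k\le n}\log|a_{n,k}|-\max_{k\in[(1-\varepsilon)n,\,n]}\log|a_{n,k}|\le\varepsilon n,$$ where $k$ runs over the integers in $\{0,\dots,n\}$ lying in the indicated intervals. -/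

import Mathlib

open Filter Topology MeasureTheory
open scoped NNReal ENNReal Polynomial

noncomputable section

/-- The polynomial `f_n = ∑_{k=0}^n a_{n,k} z^k` with coefficients `a n 0, …, a n n`. -/
def rowPoly (a : ℕ → ℕ → ℂ) (n : ℕ) : ℂ[X] :=
  ∑ k ∈ Finset.range (n + 1), Polynomial.C (a n k) * Polynomial.X ^ k

/-- The empirical zero measure `(1/n) ∑ δ_ζ`, the sum over the zeros `ζ` of `p` in the complex
plane, counted with multiplicity; it is the Riesz measure of `(1/n) log |p|` for `p ≠ 0`. -/
def empiricalMeasure (n : ℕ) (p : ℂ[X]) : FiniteMeasure ℂ :=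
  (n : ℝ≥0)⁻¹ • (p.roots.map fun ζ => (diracProba ζ).toFiniteMeasure).sum

/-- Normalized arc length on the unit circle, as a Borel measure on the complex plane: the image of
`dθ / (2π)` on `(0, 2π]` under `θ ↦ exp (i θ)`. -/
def circleMeasure : Measure ℂ :=
  ((ENNReal.ofReal (2 * Real.pi))⁻¹ • volume.restrict (Set.Ioc 0 (2 * Real.pi))).map (circleMap 0 1)

theorem isProbabilityMeasure_circleMeasure : IsProbabilityMeasure circleMeasure := by
  constructor
  have hpos : ENNReal.ofReal (2 * Real.pi) ≠ 0 := by
    simp [Real.pi_pos]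
  rw [circleMeasure, Measure.map_apply (continuous_circleMap 0 1).measurable MeasurableSet.univ]
  simp only [Set.preimage_univ, Measure.smul_apply, Measure.restrict_apply MeasurableSet.univ,
    Set.univ_inter, Real.volume_Ioc, sub_zero, smul_eq_mul]
  exact ENNReal.inv_mul_cancel hpos ENNReal.ofReal_ne_top

/-- The uniform probability measure on the unit circle. -/
def uniformCircle : ProbabilityMeasure ℂ :=
  ⟨circleMeasure, isProbabilityMeasure_circleMeasure⟩

/-- `max log |c k|` over the indices `k ∈ {0, …, n}` with `x ≤ k ≤ y`, in the extended reals, with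
`log 0 = -∞`. -/
def maxLogCoeff (c : ℕ → ℂ) (n : ℕ) (x y : ℝ) : EReal :=
  ((Finset.range (n + 1)).filter fun k : ℕ => x ≤ (k : ℝ) ∧ (k : ℝ) ≤ y).sup
    fun k => ENNReal.log ‖c k‖ₑ

end

/-! Everything passes through the Mahler measures `M(p_R)` of the dilations `p_R(z) = p(Rz)`. Write
`A` for the largest coefficient modulus. By Jensen's formula `log M(p_R) - log M(p)` is the sum over
the zeros of `log max(R,|w|) - log max(1,|w|)`, a bounded continuous function
(`log_mahlerMeasure_dilate`). On the coefficient side, `|a_k| R^k ≤ C(n,k) M(p_R)` and `M(p_R) ≤ ∑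
|a_k| R^k`.

Sufficiency. The binomial factor is `exp(o(n))` when `k` is `o(n)`-close to `0` or `n`, so
near-maximal coefficients there force `log M(p_R) = log A + n log max(1,R) + o(n)` for `R = 1/e, 1,
e`. The combination of radial kernels equal to `min(1, |log |z||)` then has integral tending to `0`,
so the zeros concentrate near the circle and no mass is lost. For the angles, the `m`-th moment of
the zeros is a Fourier coefficient of `log |p|` on the circle. Since `log |p| ≤ log A + o(n)` there,
while its mean `log M(p)` is at least `log A - o(n)`, the function is `o(n)`-close in `L¹` to a
constant and all moments with `m ≠ 0` are `o(n)`. Density of trigonometric polynomials concludes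
(`tendsto_uniformCircle_of_moments`).

Necessity. Testing weak convergence on truncated logarithms gives `|p| ≤ M(p) exp(o(n))` uniformly
on the circle, hence `A ≤ M(p) exp(o(n))`; testing it on radial kernels gives `M(p_R) ≥ M(p)
max(1,R)^n exp(-o(n))`. With `R = 1/e` or `R = e`, the sum `∑ |a_k| R^k` can be that large only if
some coefficient near the corresponding end is near-maximal
(`exists_coeff_of_mahlerMeasure_dilate`). -/

open scoped BoundedContinuousFunction

/-! ### Integrals against the circle measure and the zero measures -/

theorem integral_circleMeasure {E : Type*} [NormedAddCommGroup E] [NormedSpace ℝ E] {f : ℂ → E}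
    (hf : Continuous f) : ∫ z, f z ∂circleMeasure = Real.circleAverage f 0 1 := by
  have h2 : (0 : ℝ) ≤ 2 * Real.pi := by positivity
  rw [circleMeasure, integral_map (continuous_circleMap 0 1).measurable.aemeasurable
    hf.stronglyMeasurable.aestronglyMeasurable, integral_smul_measure,
    ENNReal.toReal_inv, ENNReal.toReal_ofReal h2, Real.circleAverage_def,
    intervalIntegral.integral_of_le h2]

theorem integral_multiset_sum_dirac {E : Type*} [NormedAddCommGroup E] [NormedSpace ℝ E]
    [CompleteSpace E] (f : ℂ → E) (s : Multiset ℂ) :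
    Integrable f ((s.map fun ζ => (diracProba ζ).toFiniteMeasure).sum : FiniteMeasure ℂ) ∧
    ∫ z, f z ∂((s.map fun ζ => (diracProba ζ).toFiniteMeasure).sum : FiniteMeasure ℂ)
      = (s.map f).sum := by
  induction s using Multiset.induction_on with
  | empty => simp
  | cons a s ih =>
    have h1 : Integrable f (((diracProba a).toFiniteMeasure : FiniteMeasure ℂ) : Measure ℂ) :=
      integrable_dirac (by simp)
    have h2 : ∫ z, f z ∂(((diracProba a).toFiniteMeasure : FiniteMeasure ℂ) : Measure ℂ) = f a :=
      integral_dirac f a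
    simp only [Multiset.map_cons, Multiset.sum_cons, FiniteMeasure.toMeasure_add]
    exact ⟨h1.add_measure ih.1, by rw [integral_add_measure h1 ih.1, h2, ih.2]⟩

theorem integral_empiricalMeasure {E : Type*} [NormedAddCommGroup E] [NormedSpace ℝ E]
    [CompleteSpace E] (f : ℂ → E) (n : ℕ) (p : ℂ[X]) :
    ∫ z, f z ∂(empiricalMeasure n p : Measure ℂ) = (n : ℝ)⁻¹ • (p.roots.map f).sum := by
  rw [empiricalMeasure, FiniteMeasure.toMeasure_smul, integral_smul_nnreal_measure,
    (integral_multiset_sum_dirac f p.roots).2, NNReal.smul_def]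
  simp

/-! ### Radial kernels and Mahler measures of dilations -/

/-- The increment `log max(R, |z|) - log max(1, |z|)`: the mean of `log |w - z|` over the circle
`|w| = R`, minus the same mean over the unit circle. -/
noncomputable def radialKernel (R : ℝ) (z : ℂ) : ℝ := Real.log (max R ‖z‖) - Real.log (max 1 ‖z‖)

theorem continuous_radialKernel {R : ℝ} (hR : 0 < R) : Continuous (radialKernel R) := by
  unfold radialKernel
  refine (Continuous.log (by fun_prop) fun z => ?_).sub (Continuous.log (by fun_prop) fun z => ?_)
  · exact (lt_max_of_lt_left hR).ne'
  · exact (lt_max_of_lt_left one_pos).ne'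

theorem abs_radialKernel_le {R : ℝ} (hR : 0 < R) (z : ℂ) : |radialKernel R z| ≤ |Real.log R| := by
  have h1 : 0 < max 1 ‖z‖ := lt_max_of_lt_left one_pos
  have h2 : 0 < max R ‖z‖ := lt_max_of_lt_left hR
  unfold radialKernel
  rw [abs_le]
  rcases le_total R 1 with h | h
  · have hl : Real.log R ≤ 0 := Real.log_nonpos hR.le h
    rw [abs_of_nonpos hl]
    have e1 : Real.log (max R ‖z‖) ≤ Real.log (max 1 ‖z‖) :=
      Real.log_le_log h2 (max_le_max_right _ h)
    have e2 : Real.log (R * max 1 ‖z‖) ≤ Real.log (max R ‖z‖) := by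
      refine Real.log_le_log (by positivity) ?_
      rw [mul_max_of_nonneg _ _ hR.le, mul_one]
      exact max_le_max_left _ (mul_le_of_le_one_left (norm_nonneg _) h)
    rw [Real.log_mul hR.ne' h1.ne'] at e2
    constructor <;> linarith
  · have hl : 0 ≤ Real.log R := Real.log_nonneg h
    rw [abs_of_nonneg hl]
    have e1 : Real.log (max 1 ‖z‖) ≤ Real.log (max R ‖z‖) :=
      Real.log_le_log h1 (max_le_max_right _ h)
    have e2 : Real.log (max R ‖z‖) ≤ Real.log (R * max 1 ‖z‖) := by
      refine Real.log_le_log (by positivity) ?_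
      rw [mul_max_of_nonneg _ _ hR.le, mul_one]
      exact max_le_max_left _ (le_mul_of_one_le_left (norm_nonneg _) h)
    rw [Real.log_mul hR.ne' h1.ne'] at e2
    constructor <;> linarith

/-- The dilation `p(R z)`. -/
noncomputable def dilate (p : ℂ[X]) (R : ℝ) : ℂ[X] := p.comp (Polynomial.C (R : ℂ) * Polynomial.X)

theorem coeff_dilate (p : ℂ[X]) (R : ℝ) (k : ℕ) : (dilate p R).coeff k = p.coeff k * (R : ℂ) ^ k :=
  Polynomial.comp_C_mul_X_coeff

/-- Mahler measure is multiplicative, and the linear factor `R X - z` has Mahler measure `max R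
‖z‖`. -/
theorem mahlerMeasure_dilate (p : ℂ[X]) {R : ℝ} (hR : 0 < R) :
    (dilate p R).mahlerMeasure =
      ‖p.leadingCoeff‖ * (p.roots.map fun z => max R ‖z‖).prod := by
  have h : dilate p R = Polynomial.C p.leadingCoeff *
      (p.roots.map fun z => Polynomial.C (R : ℂ) * Polynomial.X + Polynomial.C (-z)).prod := by
    conv_lhs => rw [dilate, (IsAlgClosed.splits p).eq_prod_roots]
    simp [Polynomial.mul_comp, Polynomial.multiset_prod_comp, sub_eq_add_neg]
  rw [h, Polynomial.mahlerMeasure_mul, Polynomial.mahlerMeasure_const,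
    Polynomial.prod_mahlerMeasure_eq_mahlerMeasure_prod, Multiset.map_map]
  congr 2
  refine Multiset.map_congr rfl fun z _ => ?_
  simp only [Function.comp]
  rw [Polynomial.mahlerMeasure_C_mul_X_add_C (by exact_mod_cast hR.ne')]
  simp [abs_of_pos hR]

theorem dilate_ne_zero {p : ℂ[X]} (hp : p ≠ 0) {R : ℝ} (hR : 0 < R) : dilate p R ≠ 0 := by
  intro h
  refine hp (Polynomial.ext fun k => ?_)
  have := coeff_dilate p R k
  rw [h] at this
  simpa [hR.ne'] using this

theorem log_prod_map_eq_sum {α : Type*} (s : Multiset α) (f : α → ℝ) (hf : ∀ x, 0 < f x) :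
    Real.log (s.map f).prod = (s.map fun x => Real.log (f x)).sum := by
  rw [Real.log_multiset_prod, Multiset.map_map]
  · rfl
  · simp only [Multiset.mem_map]
    rintro _ ⟨x, _, rfl⟩
    exact (hf x).ne'

theorem log_mahlerMeasure_dilate {p : ℂ[X]} (hp : p ≠ 0) {R : ℝ} (hR : 0 < R) :
    Real.log (dilate p R).mahlerMeasure =
      Real.log p.mahlerMeasure + (p.roots.map (radialKernel R)).sum := by
  have hl : ‖p.leadingCoeff‖ ≠ 0 := by simpa using hp
  have hpos : ∀ r : ℝ, 0 < r → ∀ z : ℂ, 0 < max r ‖z‖ := fun r hr z => lt_max_of_lt_left hr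
  have hne : ∀ r : ℝ, 0 < r → (p.roots.map fun z => max r ‖z‖).prod ≠ 0 := by
    intro r hr h
    rw [Multiset.prod_eq_zero_iff, Multiset.mem_map] at h
    obtain ⟨z, _, h⟩ := h
    exact (hpos r hr z).ne' h
  rw [mahlerMeasure_dilate p hR, Polynomial.mahlerMeasure_eq_leadingCoeff_mul_prod_roots,
    Real.log_mul hl (hne R hR), Real.log_mul hl (hne 1 one_pos),
    log_prod_map_eq_sum _ _ (hpos R hR), log_prod_map_eq_sum _ _ (hpos 1 one_pos)]
  unfold radialKernel
  rw [Multiset.sum_map_sub]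
  ring

/-! ### Coefficients versus Mahler measures; the coefficient condition without logarithms -/

theorem coeff_rowPoly (a : ℕ → ℕ → ℂ) (n k : ℕ) :
    (rowPoly a n).coeff k = if k ≤ n then a n k else 0 := by
  simp [rowPoly, Polynomial.coeff_C_mul, Polynomial.coeff_X_pow]

theorem natDegree_rowPoly_le (a : ℕ → ℕ → ℂ) (n : ℕ) : (rowPoly a n).natDegree ≤ n := by
  rw [Polynomial.natDegree_le_iff_coeff_eq_zero]
  intro k hk
  rw [coeff_rowPoly, if_neg (by omega)]

theorem norm_coeff_mul_pow_le {p : ℂ[X]} {n : ℕ} (hn : p.natDegree ≤ n) {R : ℝ} (hR : 0 < R)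
    (k : ℕ) : ‖p.coeff k‖ * R ^ k ≤ n.choose k * (dilate p R).mahlerMeasure := by
  have h := Polynomial.norm_coeff_le_choose_mul_mahlerMeasure k (dilate p R)
  rw [coeff_dilate, norm_mul, norm_pow, Complex.norm_real, Real.norm_of_nonneg hR.le] at h
  have hd : (dilate p R).natDegree ≤ n := by
    rw [Polynomial.natDegree_le_iff_coeff_eq_zero]
    intro j hj
    rw [coeff_dilate, Polynomial.coeff_eq_zero_of_natDegree_lt (by omega), zero_mul]
  refine h.trans ?_
  have := Polynomial.mahlerMeasure_nonneg (dilate p R)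
  gcongr

theorem mahlerMeasure_dilate_le {p : ℂ[X]} {n : ℕ} (hn : p.natDegree ≤ n) {R : ℝ} (hR : 0 < R) :
    (dilate p R).mahlerMeasure ≤ ∑ k ∈ Finset.range (n + 1), ‖p.coeff k‖ * R ^ k := by
  refine (Polynomial.mahlerMeasure_le_sum_norm_coeff _).trans ?_
  rw [Polynomial.sum_def]
  refine (Finset.sum_le_sum_of_subset_of_nonneg (t := Finset.range (n + 1)) ?_ ?_).trans
    (Finset.sum_le_sum fun k _ => ?_)
  · intro k hk
    rw [Polynomial.mem_support_iff, coeff_dilate] at hk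
    have := Polynomial.le_natDegree_of_ne_zero (left_ne_zero_of_mul hk)
    simp; omega
  · intros; positivity
  · rw [coeff_dilate, norm_mul, norm_pow, Complex.norm_real, Real.norm_of_nonneg hR.le]

theorem maxLogCoeff_sub_le_iff (c : ℕ → ℂ) (n : ℕ) (x y ε : ℝ)
    (hne : ∃ k ≤ n, x ≤ (k : ℝ) ∧ (k : ℝ) ≤ y) :
    maxLogCoeff c n 0 n - maxLogCoeff c n x y ≤ ((ε * n : ℝ) : EReal) ↔
      ∃ k ≤ n, (x ≤ (k : ℝ) ∧ (k : ℝ) ≤ y) ∧ ∀ j ≤ n, ‖c j‖ ≤ Real.exp (ε * n) * ‖c k‖ := by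
  have key : ∀ k j, ENNReal.log ‖c j‖ₑ ≤ ((ε * n : ℝ) : EReal) + ENNReal.log ‖c k‖ₑ ↔
      ‖c j‖ ≤ Real.exp (ε * n) * ‖c k‖ := by
    intro k j
    have h1 : ((ε * n : ℝ) : EReal) = ENNReal.log (ENNReal.ofReal (Real.exp (ε * n))) := by
      rw [ENNReal.log_ofReal_of_pos (Real.exp_pos _), Real.log_exp]
    rw [h1, ← ENNReal.log_mul_add, ENNReal.log_le_log_iff, ← ofReal_norm,
      ← ofReal_norm, ← ENNReal.ofReal_mul (Real.exp_pos _).le,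
      ENNReal.ofReal_le_ofReal_iff (by positivity)]
  -- Finiteness of the right-hand bound alone justifies transposing in `EReal`, even when a maximum
  -- is `-∞`.
  rw [EReal.sub_le_iff_le_add (Or.inr (EReal.coe_ne_top _)) (Or.inr (EReal.coe_ne_bot _))]
  constructor
  · intro h
    have hs : ((Finset.range (n + 1)).filter fun k : ℕ => x ≤ (k : ℝ) ∧ (k : ℝ) ≤ y).Nonempty := by
      obtain ⟨k, hk, hk'⟩ := hne
      exact ⟨k, by simp [hk, hk']⟩
    obtain ⟨k, hk, e⟩ := Finset.exists_mem_eq_sup _ hs fun k => ENNReal.log ‖c k‖ₑ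
    rw [maxLogCoeff, maxLogCoeff, e] at h
    simp only [Finset.mem_filter, Finset.mem_range, Nat.lt_succ_iff] at hk
    refine ⟨k, hk.1, hk.2, fun j hj => (key k j).1 (le_trans ?_ h)⟩
    exact Finset.le_sup (f := fun k => ENNReal.log ‖c k‖ₑ) (by simpa [Nat.lt_succ_iff] using hj)
  · rintro ⟨k, hk, hk', h⟩
    have : ENNReal.log ‖c k‖ₑ ≤ maxLogCoeff c n x y :=
      Finset.le_sup (f := fun k => ENNReal.log ‖c k‖ₑ) (by simp [hk, hk'])
    refine Finset.sup_le fun j hj => ((key k j).2 (h j ?_)).trans (by gcongr)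
    simp at hj; omega

/-! ### Fourier coefficients of `log |p|` on the unit circle -/

theorem circleAverage_zpow (j : ℤ) :
    Real.circleAverage (fun z : ℂ => z ^ j) 0 1 = if j = 0 then 1 else 0 := by
  split_ifs with h
  · simp [h, Real.circleAverage_const]
  · rw [Real.circleAverage_eq_circleIntegral one_ne_zero]
    have : (∮ z in C(0, 1), (z - 0)⁻¹ • z ^ j) = ∮ z in C(0, 1), (z - (0 : ℂ)) ^ (j - 1) := by
      refine circleIntegral.integral_congr zero_le_one fun z hz => ?_
      have hz0 : z ≠ 0 := by
        rintro rfl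
        simp at hz
      simp only [sub_zero, smul_eq_mul]
      rw [zpow_sub_one₀ hz0, mul_comm]
    rw [this, circleIntegral.integral_sub_zpow_of_ne (by omega), smul_zero]

theorem hasSum_circleAverage {F : ℕ → ℂ → ℂ} {f : ℂ → ℂ} {b : ℕ → ℝ} (hb : Summable b)
    (hF : ∀ k, ContinuousOn (F k) (Metric.sphere 0 1))
    (hFb : ∀ k, ∀ z ∈ Metric.sphere (0 : ℂ) 1, ‖F k z‖ ≤ b k)
    (hf : ∀ z ∈ Metric.sphere (0 : ℂ) 1, HasSum (fun k => F k z) (f z)) :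
    HasSum (fun k => Real.circleAverage (F k) 0 1) (Real.circleAverage f 0 1) := by
  have hm : ∀ θ, circleMap 0 1 θ ∈ Metric.sphere (0 : ℂ) 1 := circleMap_mem_sphere 0 zero_le_one
  simp only [Real.circleAverage_def]
  refine HasSum.const_smul _ ?_
  refine intervalIntegral.hasSum_integral_of_dominated_convergence (fun k _ => b k) (fun k => ?_)
    (fun k => ae_of_all _ fun θ _ => hFb k _ (hm θ)) (ae_of_all _ fun _ _ => hb)
    intervalIntegrable_const (ae_of_all _ fun θ _ => hf _ (hm θ))
  exact ((hF k).comp_continuous (continuous_circleMap 0 1) hm).aestronglyMeasurable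

/-- The function `z ^ m` on the closed unit disk, extended to the plane by inversion in the unit
circle. -/
noncomputable def diskPow (m : ℕ) (z : ℂ) : ℂ := (z / (max 1 ‖z‖ : ℝ) ^ 2) ^ m

theorem continuous_diskPow (m : ℕ) : Continuous (diskPow m) := by
  unfold diskPow
  refine (Continuous.div continuous_id (by fun_prop) fun z => ?_).pow m
  have : max 1 ‖z‖ ≠ 0 := (lt_max_of_lt_left one_pos).ne'
  exact pow_ne_zero _ (by exact_mod_cast this)

theorem norm_diskPow_le (m : ℕ) (z : ℂ) : ‖diskPow m z‖ ≤ 1 := by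
  have h : 0 < max 1 ‖z‖ := lt_max_of_lt_left one_pos
  rw [diskPow, norm_pow, norm_div, norm_pow, Complex.norm_real, Real.norm_of_nonneg h.le]
  refine pow_le_one₀ (by positivity) (div_le_one_of_le₀ ?_ (by positivity))
  nlinarith [le_max_left 1 ‖z‖, le_max_right 1 ‖z‖]

theorem diskPow_of_norm_le_one {z : ℂ} (hz : ‖z‖ ≤ 1) (m : ℕ) : diskPow m z = z ^ m := by
  simp [diskPow, max_eq_left hz]

theorem diskPow_of_one_le_norm {z : ℂ} (hz : 1 ≤ ‖z‖) (m : ℕ) :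
    diskPow m z = (starRingEnd ℂ z)⁻¹ ^ m := by
  have h0 : z ≠ 0 := by
    rintro rfl
    simp at hz
    linarith
  rw [diskPow, max_eq_right hz, ← Complex.mul_conj']
  congr 1
  field_simp

theorem circleIntegrable_log_norm_sub_smul_pow (m : ℕ) (w : ℂ) :
    CircleIntegrable (fun z => Real.log ‖z - w‖ • z ^ m) 0 1 := by
  have h : CircleIntegrable (fun z => Real.log ‖z - w‖) 0 1 :=
    circleIntegrable_log_norm_sub_const 1
  exact IntervalIntegrable.smul_continuousOn (f := fun θ => Real.log ‖circleMap 0 1 θ - w‖)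
    (g := fun θ => circleMap 0 1 θ ^ m) h (by fun_prop)

/-- On the circle `log |z - w| = -Re ∑ (w/z)^k / k`; after multiplication by `z ^ m`, orthogonality
leaves only the term `k = m`. -/
theorem circleAverage_log_norm_sub_smul_pow_of_lt {m : ℕ} (hm : m ≠ 0) {w : ℂ} (hw : ‖w‖ < 1) :
    Real.circleAverage (fun z => Real.log ‖z - w‖ • z ^ m) 0 1 = -(w ^ m / (2 * m)) := by
  -- The `k = 0` term vanishes because division by zero returns zero.
  let F : ℕ → ℂ → ℂ := fun k z =>
    -(w ^ k / (2 * k)) * z ^ ((m : ℤ) - k) - (starRingEnd ℂ w ^ k / (2 * k)) * z ^ ((m : ℤ) + k)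
  have hz0 : ∀ z ∈ Metric.sphere (0 : ℂ) 1, z ≠ 0 := by
    rintro z hz rfl
    simp at hz
  have hF : ∀ k, ContinuousOn (F k) (Metric.sphere 0 1) := by
    intro k z hz
    have h0 := hz0 z hz
    refine ContinuousAt.continuousWithinAt ?_
    exact (continuousAt_const.mul (continuousAt_zpow₀ z _ (Or.inl h0))).sub
      (continuousAt_const.mul (continuousAt_zpow₀ z _ (Or.inl h0)))
  have hFb : ∀ k, ∀ z ∈ Metric.sphere (0 : ℂ) 1, ‖F k z‖ ≤ ‖w‖ ^ k := by
    intro k z hz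
    have hz1 : ‖z‖ = 1 := by simpa using hz
    rcases Nat.eq_zero_or_pos k with rfl | hk
    · simp [F]
    · have hk' : (1 : ℝ) ≤ k := by exact_mod_cast hk
      have : ‖w‖ ^ k / (2 * k) ≤ ‖w‖ ^ k / 2 := by
        gcongr
        linarith
      refine (norm_sub_le _ _).trans ?_
      simp only [norm_mul, norm_neg, norm_div, norm_pow, norm_zpow, hz1, one_zpow, mul_one,
        RCLike.norm_conj, Complex.norm_natCast, Complex.norm_ofNat]
      linarith
  have hf : ∀ z ∈ Metric.sphere (0 : ℂ) 1,
      HasSum (fun k => F k z) (Real.log ‖z - w‖ • z ^ m) := by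
    intro z hz
    have h0 := hz0 z hz
    have hz1 : ‖z‖ = 1 := by simpa using hz
    have hconj : starRingEnd ℂ z = z⁻¹ := by
      rw [Complex.inv_def, Complex.normSq_eq_norm_sq, hz1]
      simp
    have hu : ‖w * z⁻¹‖ < 1 := by simpa [hz1] using hw
    have e : Real.log ‖z - w‖ = (Complex.log (1 - w * z⁻¹)).re := by
      rw [Complex.log_re]
      congr 1
      rw [show z - w = z * (1 - w * z⁻¹) by field_simp, norm_mul, hz1, one_mul]
    have s1 := Complex.hasSum_taylorSeries_neg_log hu
    have s2 : HasSum (fun k : ℕ => starRingEnd ℂ ((w * z⁻¹) ^ k / k)) _ :=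
      (Complex.hasSum_conj').2 s1
    have s3 := (s1.add s2).mul_left (-(z ^ m / 2))
    convert! s3 using 1
    · ext k
      simp only [F, map_div₀, map_pow, map_mul, map_inv₀, hconj, inv_inv, map_natCast, mul_pow,
        inv_pow, zpow_sub₀ h0, zpow_add₀ h0, zpow_natCast]
      field_simp
      ring
    · rw [Complex.real_smul, e, Complex.re_eq_add_conj, map_neg]
      ring
  have hs := hasSum_circleAverage (summable_geometric_of_lt_one (norm_nonneg w) hw) hF hFb hf
  have hterm : ∀ k, Real.circleAverage (F k) 0 1 = if k = m then -(w ^ m / (2 * m)) else 0 := by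
    intro k
    have ci : ∀ j : ℤ, CircleIntegrable (fun z : ℂ => z ^ j) 0 1 := by
      intro j
      refine ContinuousOn.circleIntegrable zero_le_one fun z hz => ?_
      exact (continuousAt_zpow₀ z _ (Or.inl (hz0 z hz))).continuousWithinAt
    have e : F k = (-(w ^ k / (2 * k))) • (fun z : ℂ => z ^ ((m : ℤ) - k)) -
        (starRingEnd ℂ w ^ k / (2 * k)) • (fun z : ℂ => z ^ ((m : ℤ) + k)) := rfl
    rw [e, Real.circleAverage_sub ((ci _).const_smul) ((ci _).const_smul), Real.circleAverage_smul,
      Real.circleAverage_smul, circleAverage_zpow, circleAverage_zpow,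
      if_neg (show (m : ℤ) + k ≠ 0 by omega)]
    by_cases hk : k = m
    · subst hk
      simp
    · rw [if_neg (show (m : ℤ) - k ≠ 0 by omega), if_neg hk]
      simp
  simp only [hterm] at hs
  exact hs.unique (hasSum_ite_eq m _)

theorem ae_circleMap_notMem {s : Set ℂ} (hs : s.Countable) : ∀ᵐ θ : ℝ, circleMap 0 1 θ ∉ s := by
  have := (hs.preimage_circleMap 0 one_ne_zero).measure_zero volume
  exact measure_eq_zero_iff_ae_notMem.1 this

/-- Limit `r ↑ 1` of the interior case at `r w`, by dominated convergence. -/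
theorem circleAverage_log_norm_sub_smul_pow_of_eq {m : ℕ} (hm : m ≠ 0) {w : ℂ} (hw : ‖w‖ = 1) :
    Real.circleAverage (fun z => Real.log ‖z - w‖ • z ^ m) 0 1 = -(w ^ m / (2 * m)) := by
  have h1 : Tendsto (fun r : ℝ => Real.circleAverage (fun z => Real.log ‖z - r * w‖ • z ^ m) 0 1)
      (𝓝[<] 1) (𝓝 (Real.circleAverage (fun z => Real.log ‖z - w‖ • z ^ m) 0 1)) := by
    simp only [Real.circleAverage_def]
    refine Tendsto.const_smul ?_ _
    have hint : IntervalIntegrable (fun θ => Real.log 2 + |Real.log ‖circleMap 0 1 θ - w‖|) volume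
        0 (2 * Real.pi) := by
      have h : CircleIntegrable (fun z => Real.log ‖z - w‖) 0 1 :=
        circleIntegrable_log_norm_sub_const 1
      exact intervalIntegrable_const.add (IntervalIntegrable.abs h)
    have hev : ∀ᶠ r : ℝ in 𝓝[<] 1, r ∈ Set.Ioo (0 : ℝ) 1 := Ioo_mem_nhdsLT one_pos
    refine intervalIntegral.tendsto_integral_filter_of_dominated_convergence _ ?_ ?_ hint ?_
    · refine Eventually.of_forall fun r => ?_
      exact (intervalIntegrable_iff.1
        (circleIntegrable_log_norm_sub_smul_pow m (r * w))).aestronglyMeasurable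
    · filter_upwards [hev] with r hr
      filter_upwards [ae_circleMap_notMem (Set.countable_singleton w)] with θ hθ _
      set z := circleMap 0 1 θ
      have hz1 : ‖z‖ = 1 := by simp [z]
      have hpos : 0 < ‖z - w‖ := norm_pos_iff.2 (sub_ne_zero.2 hθ)
      have hrw : ‖(r : ℂ) * w‖ = r := by simp [hw, abs_of_pos hr.1]
      have hrw' : ‖(r : ℂ) * w - w‖ = 1 - r := by
        rw [show (r : ℂ) * w - w = ((r - 1 : ℝ) : ℂ) * w by push_cast; ring, norm_mul, hw,
          Complex.norm_real, Real.norm_eq_abs, abs_of_neg (by linarith [hr.2])]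
        ring
      -- `a1` and `a2` give `‖z - w‖ ≤ 2 ‖z - r w‖`, so the logarithmic singularity at `w` dominates
      -- uniformly in `r`.
      have a1 : 1 - r ≤ ‖z - r * w‖ := by
        have := norm_sub_norm_le z (r * w)
        rwa [hz1, hrw] at this
      have a2 : ‖z - w‖ ≤ ‖z - r * w‖ + (1 - r) := by
        rw [← hrw']
        exact norm_sub_le_norm_sub_add_norm_sub z (r * w) w
      have a3 : ‖z - r * w‖ ≤ 2 := by
        refine (norm_sub_le _ _).trans ?_
        rw [hz1, hrw]
        linarith [hr.2]
      rw [norm_smul, norm_pow, hz1, one_pow, mul_one, Real.norm_eq_abs, abs_le]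
      have l1 : Real.log (‖z - w‖ / 2) ≤ Real.log ‖z - r * w‖ :=
        Real.log_le_log (by positivity) (by linarith)
      rw [Real.log_div hpos.ne' two_ne_zero] at l1
      have l2 : Real.log ‖z - r * w‖ ≤ Real.log 2 :=
        Real.log_le_log (by linarith [hr.2]) a3
      have := neg_abs_le (Real.log ‖z - w‖)
      have := abs_nonneg (Real.log ‖z - w‖)
      constructor <;> linarith
    · filter_upwards [ae_circleMap_notMem (Set.countable_singleton w)] with θ hθ _
      have hpos : ‖circleMap 0 1 θ - w‖ ≠ 0 := norm_ne_zero_iff.2 (sub_ne_zero.2 hθ)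
      refine Tendsto.smul_const ?_ _
      refine Tendsto.log ?_ hpos
      have : Tendsto (fun r : ℝ => ‖circleMap 0 1 θ - r * w‖) (𝓝 1)
          (𝓝 ‖circleMap 0 1 θ - (1 : ℝ) * w‖) := by
        refine Continuous.tendsto ?_ 1
        fun_prop
      simpa using this.mono_left nhdsWithin_le_nhds
  have h2 : Tendsto (fun r : ℝ => Real.circleAverage (fun z => Real.log ‖z - r * w‖ • z ^ m) 0 1)
      (𝓝[<] 1) (𝓝 (-(w ^ m / (2 * m)))) := by
    have hc : Tendsto (fun r : ℝ => -(((r : ℂ) * w) ^ m / (2 * m))) (𝓝[<] 1)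
        (𝓝 (-((((1 : ℝ) : ℂ) * w) ^ m / (2 * m)))) := by
      refine Tendsto.mono_left (Continuous.tendsto ?_ 1) nhdsWithin_le_nhds
      fun_prop
    simp only [Complex.ofReal_one, one_mul] at hc
    refine hc.congr' ?_
    filter_upwards [Ioo_mem_nhdsLT (zero_lt_one (α := ℝ))] with r hr
    refine (circleAverage_log_norm_sub_smul_pow_of_lt hm ?_).symm
    rw [norm_mul, hw, Complex.norm_real, Real.norm_of_nonneg hr.1.le, mul_one]
    exact hr.2
  exact tendsto_nhds_unique h1 h2

/-- An exterior point is reflected to `v = 1 / conj w`: on the circle `|z - w| = |w| |z - v|`, and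
the constant `log |w|` averages to zero against `z ^ m`. This is why `diskPow` is extended by
inversion. -/
theorem circleAverage_log_norm_sub_smul_pow {m : ℕ} (hm : m ≠ 0) (w : ℂ) :
    Real.circleAverage (fun z => Real.log ‖z - w‖ • z ^ m) 0 1 = -(diskPow m w / (2 * m)) := by
  rcases lt_trichotomy ‖w‖ 1 with h | h | h
  · rw [circleAverage_log_norm_sub_smul_pow_of_lt hm h, diskPow_of_norm_le_one h.le]
  · rw [circleAverage_log_norm_sub_smul_pow_of_eq hm h, diskPow_of_norm_le_one h.le]
  · have hw0 : w ≠ 0 := by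
      rintro rfl
      simp at h
      linarith
    set v := (starRingEnd ℂ w)⁻¹ with hv
    have hv1 : ‖v‖ < 1 := by
      rw [hv, norm_inv, RCLike.norm_conj]
      exact inv_lt_one_of_one_lt₀ h
    have e : Real.circleAverage (fun z => Real.log ‖z - w‖ • z ^ m) 0 1 =
        Real.circleAverage ((fun z => Real.log ‖z - v‖ • z ^ m) +
          Real.log ‖w‖ • fun z : ℂ => z ^ (m : ℤ)) 0 1 := by
      refine Real.circleAverage_congr_sphere fun z hz => ?_
      have hz1 : ‖z‖ = 1 := by simpa using hz
      have hz0 : z ≠ 0 := by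
        rintro rfl
        simp at hz1
      have hne : z - v ≠ 0 := by
        intro h0
        rw [← sub_eq_zero.1 h0, hz1] at hv1
        exact lt_irrefl _ hv1
      have hconj : starRingEnd ℂ z = z⁻¹ := by
        rw [Complex.inv_def, Complex.normSq_eq_norm_sq, hz1]
        simp
      have : ‖z - w‖ = ‖z - v‖ * ‖w‖ := by
        rw [← RCLike.norm_conj (z - v), map_sub, hconj, hv, map_inv₀, Complex.conj_conj,
          ← norm_mul, sub_mul, inv_mul_cancel₀ hw0,
          show z⁻¹ * w - 1 = -(z⁻¹ * (z - w)) by field_simp; ring, norm_neg, norm_mul, norm_inv,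
          hz1]
        simp
      simp only [Pi.add_apply, Pi.smul_apply, zpow_natCast]
      rw [this, Real.log_mul (norm_ne_zero_iff.2 hne) (norm_ne_zero_iff.2 hw0), add_smul]
    have ci : CircleIntegrable (Real.log ‖w‖ • fun z : ℂ => z ^ (m : ℤ)) 0 1 :=
      ContinuousOn.circleIntegrable zero_le_one
        (by simp only [zpow_natCast]; exact (continuousOn_pow m).const_smul _)
    rw [e, Real.circleAverage_add (circleIntegrable_log_norm_sub_smul_pow m v) ci,
      Real.circleAverage_smul, circleAverage_zpow, if_neg (by exact_mod_cast hm),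
      circleAverage_log_norm_sub_smul_pow_of_lt hm hv1, diskPow_of_one_le_norm h.le]
    simp [hv]

theorem circleAverage_sum_log_norm_sub_smul_pow {m : ℕ} (hm : m ≠ 0) (s : Multiset ℂ) :
    CircleIntegrable (fun z => (s.map fun w => Real.log ‖z - w‖).sum • z ^ m) 0 1 ∧
    Real.circleAverage (fun z => (s.map fun w => Real.log ‖z - w‖).sum • z ^ m) 0 1 =
      -((s.map (diskPow m)).sum / (2 * m)) := by
  induction s using Multiset.induction_on with
  | empty => simp [circleIntegrable_const, Real.circleAverage_const]
  | cons a s ih =>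
    have h1 := circleIntegrable_log_norm_sub_smul_pow m a
    simp only [Multiset.map_cons, Multiset.sum_cons, add_smul]
    refine ⟨h1.add ih.1, ?_⟩
    have := Real.circleAverage_add h1 ih.1
    rw [ih.2, circleAverage_log_norm_sub_smul_pow hm] at this
    refine this.trans ?_
    ring

theorem norm_eval_eq_prod_roots (p : ℂ[X]) (z : ℂ) :
    ‖p.eval z‖ = ‖p.leadingCoeff‖ * (p.roots.map fun w => ‖z - w‖).prod := by
  conv_lhs => rw [(IsAlgClosed.splits p).eval_eq_prod_roots]
  rw [norm_mul]
  congr 1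
  induction p.roots using Multiset.induction_on with
  | empty => simp
  | cons a s ih => simp [ih]

/-- The leading coefficient and the shift `c` contribute constants, which have no `m`-th Fourier
coefficient. Thus `c` is free to be chosen as the size of `log ‖p‖`. -/
theorem circleAverage_log_norm_eval_smul_pow {p : ℂ[X]} (hp : p ≠ 0) {m : ℕ} (hm : m ≠ 0) (c : ℝ) :
    Real.circleAverage (fun z => (Real.log ‖p.eval z‖ - c) • z ^ m) 0 1 =
      -((p.roots.map (diskPow m)).sum / (2 * m)) := by
  have ci : CircleIntegrable ((Real.log ‖p.leadingCoeff‖ - c) • fun z : ℂ => z ^ (m : ℤ)) 0 1 :=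
    ContinuousOn.circleIntegrable zero_le_one
      (by simp only [zpow_natCast]; exact (continuousOn_pow m).const_smul _)
  obtain ⟨h1, h2⟩ := circleAverage_sum_log_norm_sub_smul_pow hm p.roots
  have h3 := Real.circleAverage_add h1 ci
  rw [h2, Real.circleAverage_smul, circleAverage_zpow, if_neg (by exact_mod_cast hm), smul_zero,
    add_zero] at h3
  rw [← h3, Real.circleAverage_def, Real.circleAverage_def]
  congr 1
  refine intervalIntegral.integral_congr_ae ?_
  filter_upwards [ae_circleMap_notMem (p.roots.toFinset.countable_toSet)] with θ hθ _
  have hroot : ∀ w ∈ p.roots, circleMap 0 1 θ - w ≠ 0 := by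
    intro w hw h
    rw [sub_eq_zero.1 h] at hθ
    exact hθ (by simpa using hw)
  have : Real.log ‖p.eval (circleMap 0 1 θ)‖ =
      (p.roots.map fun w => Real.log ‖circleMap 0 1 θ - w‖).sum + Real.log ‖p.leadingCoeff‖ := by
    have hprod : (p.roots.map fun w => ‖circleMap 0 1 θ - w‖).prod ≠ 0 := by
      rw [Ne, Multiset.prod_eq_zero_iff, Multiset.mem_map]
      rintro ⟨w, hw, h⟩
      exact hroot w hw (norm_eq_zero.1 h)
    rw [norm_eval_eq_prod_roots, Real.log_mul (by simpa using hp) hprod, add_comm,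
      Real.log_multiset_prod, Multiset.map_map]
    · rfl
    · simp only [Multiset.mem_map]
      rintro _ ⟨w, hw, rfl⟩
      exact norm_ne_zero_iff.2 (hroot w hw)
  simp only [Pi.add_apply, Pi.smul_apply, zpow_natCast]
  rw [this, ← add_smul]
  congr 1
  ring

/-- An upper bound and the mean control the `L¹` norm: if `u = log ‖p‖ - c ≤ b` with `b ≥ 0`, then
`|u| ≤ 2b - u`, whose mean is `2b + c - log M(p)`. -/
theorem norm_sum_diskPow_le {p : ℂ[X]} (hp : p ≠ 0) {m : ℕ} (hm : m ≠ 0) {b c : ℝ} (hb : 0 ≤ b)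
    (hbc : ∀ z ∈ Metric.sphere (0 : ℂ) 1, p.eval z ≠ 0 → Real.log ‖p.eval z‖ ≤ c + b) :
    ‖(p.roots.map (diskPow m)).sum‖ ≤ 2 * m * (2 * b + (c - Real.log p.mahlerMeasure)) := by
  have hm' : (0 : ℝ) < m := by positivity
  have h1 : ‖Real.circleAverage (fun z => (Real.log ‖p.eval z‖ - c) • z ^ m) 0 1‖ ≤
      2 * b + (c - Real.log p.mahlerMeasure) := by
    have hi : CircleIntegrable (fun z => Real.log ‖p.eval z‖) 0 1 :=
      p.intervalIntegrable_mahlerMeasure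
    have hc : CircleIntegrable (fun _ : ℂ => 2 * b + c) 0 1 := circleIntegrable_const _ _ _
    have e : Real.circleAverage ((fun _ : ℂ => 2 * b + c) - fun z => Real.log ‖p.eval z‖) 0 1 =
        2 * b + (c - Real.log p.mahlerMeasure) := by
      rw [Real.circleAverage_sub hc hi, Real.circleAverage_const,
        ← Polynomial.logMahlerMeasure_eq_log_MahlerMeasure, Polynomial.logMahlerMeasure_def]
      ring
    rw [← e, Real.circleAverage_def, Real.circleAverage_def, norm_smul, smul_eq_mul,
      Real.norm_of_nonneg (by positivity)]
    refine mul_le_mul_of_nonneg_left ?_ (by positivity)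
    refine intervalIntegral.norm_integral_le_of_norm_le (by positivity) ?_ (hc.sub hi)
    filter_upwards [ae_circleMap_notMem (p.roots.toFinset.countable_toSet)] with θ hθ _
    have := hbc _ (circleMap_mem_sphere 0 zero_le_one θ) fun h0 => hθ (by simpa [hp] using h0)
    rw [norm_smul, norm_pow, norm_circleMap_zero, abs_one, one_pow, mul_one, Real.norm_eq_abs,
      abs_le]
    simp only [Pi.sub_apply]
    constructor <;> linarith
  rw [circleAverage_log_norm_eval_smul_pow hp hm, norm_neg, norm_div,
    div_le_iff₀ (by simpa using Nat.pos_of_ne_zero hm)] at h1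
  refine h1.trans (le_of_eq ?_)
  simp
  ring

/-! ### Test functions and a moment criterion for convergence to the circle -/

/-- The radial kernel as a bounded continuous function. -/
noncomputable def radialKernelBCF {R : ℝ} (hR : 0 < R) : ℂ →ᵇ ℝ :=
  BoundedContinuousFunction.ofNormedAddCommGroup (radialKernel R) (continuous_radialKernel hR)
    |Real.log R| (abs_radialKernel_le hR)

/-- The function `diskPow m` as a bounded continuous function. -/
noncomputable def diskPowBCF (m : ℕ) : ℂ →ᵇ ℂ :=
  BoundedContinuousFunction.ofNormedAddCommGroup (diskPow m) (continuous_diskPow m) 1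
    (norm_diskPow_le m)

/-- The function `min(1, |log |z||)`, written as a combination of radial kernels. -/
noncomputable def circleGap : ℂ →ᵇ ℝ :=
  1 - radialKernelBCF (Real.exp_pos 1) - radialKernelBCF (Real.exp_pos (-1))

theorem circleGap_apply (z : ℂ) :
    circleGap z = 1 - radialKernel (Real.exp 1) z - radialKernel (Real.exp (-1)) z := rfl

theorem circleGap_of_exp_one_le {z : ℂ} (hz : Real.exp 1 ≤ ‖z‖) : circleGap z = 1 := by
  have h1 : 1 ≤ Real.exp 1 := Real.one_le_exp zero_le_one
  have h2 : Real.exp (-1) ≤ 1 := Real.exp_le_one_iff.2 (by norm_num)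
  simp [circleGap_apply, radialKernel, max_eq_right hz, max_eq_right (h1.trans hz),
    max_eq_right ((h2.trans h1).trans hz)]

theorem circleGap_pos {z : ℂ} (hz : ‖z‖ ≠ 1) : 0 < circleGap z := by
  have h1 : 1 ≤ Real.exp 1 := Real.one_le_exp zero_le_one
  have h2 : Real.exp (-1) < 1 := Real.exp_lt_one_iff.2 (by norm_num)
  rcases lt_or_gt_of_ne hz with h | h
  · have : Real.log (max (Real.exp (-1)) ‖z‖) < 0 :=
      Real.log_neg (lt_max_of_lt_left (Real.exp_pos _)) (max_lt h2 h)
    rw [circleGap_apply, radialKernel, radialKernel, max_eq_left h.le,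
      max_eq_left (h.le.trans h1)]
    simpa using this
  · rcases le_total (Real.exp 1) ‖z‖ with h' | h'
    · rw [circleGap_of_exp_one_le h']
      exact one_pos
    · have := Real.log_pos h
      rw [circleGap_apply, radialKernel, radialKernel, max_eq_right h.le, max_eq_left h',
        max_eq_right (h2.le.trans h.le)]
      simpa using this

theorem circleGap_nonneg (z : ℂ) : 0 ≤ circleGap z := by
  rcases eq_or_ne ‖z‖ 1 with h | h
  · have h1 : 1 ≤ Real.exp 1 := Real.one_le_exp zero_le_one
    have h2 : Real.exp (-1) ≤ 1 := Real.exp_le_one_iff.2 (by norm_num)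
    rw [circleGap_apply, radialKernel, radialKernel, h, max_eq_left h1, max_eq_right h2]
    simp
  · exact (circleGap_pos h).le

/-- Where `‖h‖ ≥ η`, `circleGap` is bounded below: by compactness inside radius `e`, and because it
equals `1` beyond. -/
theorem exists_norm_le_add_mul_circleGap (h : ℂ →ᵇ ℂ) {η : ℝ} (hη : 0 < η)
    (hh : ∀ z : ℂ, ‖z‖ = 1 → ‖h z‖ < η) :
    ∃ C, 0 ≤ C ∧ ∀ z, ‖h z‖ ≤ η + C * circleGap z := by
  let S : Set ℂ := Metric.closedBall 0 (Real.exp 1) ∩ {z | η ≤ ‖h z‖}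
  have hS : IsCompact S := (isCompact_closedBall 0 _).inter_right
    (isClosed_le continuous_const h.continuous.norm)
  have hpos : ∀ z ∈ S, 0 < circleGap z := by
    intro z hz
    refine circleGap_pos fun h1 => ?_
    exact absurd hz.2 (not_le.2 (hh z h1))
  obtain ⟨c, hc, hcS⟩ : ∃ c, 0 < c ∧ ∀ z ∈ S, c ≤ circleGap z := by
    rcases S.eq_empty_or_nonempty with he | hne
    · exact ⟨1, one_pos, by simp [he]⟩
    · obtain ⟨z, hz, hmin⟩ := hS.exists_isMinOn hne circleGap.continuous.continuousOn
      exact ⟨_, hpos z hz, fun w hw => hmin hw⟩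
  refine ⟨‖h‖ / min c 1, by positivity, fun z => ?_⟩
  have hC : 0 ≤ ‖h‖ / min c 1 := by positivity
  rcases lt_or_ge ‖h z‖ η with hz | hz
  · have := mul_nonneg hC (circleGap_nonneg z)
    linarith
  · have hgap : min c 1 ≤ circleGap z := by
      rcases le_total ‖z‖ (Real.exp 1) with h1 | h1
      · exact (min_le_left _ _).trans (hcS z ⟨by simpa using h1, hz⟩)
      · rw [circleGap_of_exp_one_le h1]
        exact min_le_right _ _
    have hm : 0 < min c 1 := lt_min hc one_pos
    have : ‖h‖ ≤ ‖h‖ / min c 1 * circleGap z := by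
      rw [div_mul_eq_mul_div, le_div_iff₀ hm]
      gcongr
    linarith [h.norm_coe_le_norm z]

theorem integral_diskPow_circleMeasure {m : ℕ} (hm : m ≠ 0) :
    ∫ z, diskPow m z ∂circleMeasure = 0 := by
  rw [integral_circleMeasure (continuous_diskPow m)]
  have : Real.circleAverage (diskPow m) 0 1 = Real.circleAverage (fun z : ℂ => z ^ (m : ℤ)) 0 1 := by
    refine Real.circleAverage_congr_sphere fun z hz => ?_
    have hz1 : ‖z‖ = 1 := by simpa using hz
    simp [diskPow_of_norm_le_one hz1.le]
  rw [this, circleAverage_zpow, if_neg (by exact_mod_cast hm)]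

instance : Fact (0 < 2 * Real.pi) := ⟨Real.two_pi_pos⟩

theorem fourier_coe_eq_circleMap_zpow (j : ℤ) (θ : ℝ) :
    fourier j (θ : AddCircle (2 * Real.pi)) = circleMap 0 1 θ ^ j := by
  rw [fourier_coe_apply, circleMap_zero, Complex.ofReal_one, one_mul, ← Complex.exp_int_mul]
  congr 1
  have : (Real.pi : ℂ) ≠ 0 := by exact_mod_cast Real.pi_ne_zero
  push_cast
  field_simp

/-- The characters extend to the plane as `diskPow m` and its conjugate, whose integrals converge by
hypothesis; both properties survive linear combinations. -/
theorem exists_extension_of_mem_span_fourier {μ : ℕ → FiniteMeasure ℂ}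
    (hmass : Tendsto (fun n => ∫ _, (1 : ℂ) ∂(μ n : Measure ℂ)) atTop (𝓝 1))
    (hpow : ∀ m : ℕ, m ≠ 0 →
      Tendsto (fun n => ∫ z, diskPow m z ∂(μ n : Measure ℂ)) atTop (𝓝 0))
    {g : C(AddCircle (2 * Real.pi), ℂ)}
    (hg : g ∈ Submodule.span ℂ (Set.range (@fourier (2 * Real.pi)))) :
    ∃ G : ℂ →ᵇ ℂ, (∀ θ : ℝ, G (circleMap 0 1 θ) = g θ) ∧
      Tendsto (fun n => ∫ z, G z ∂(μ n : Measure ℂ)) atTop (𝓝 (∫ z, G z ∂circleMeasure)) := by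
  have := isProbabilityMeasure_circleMeasure
  induction hg using Submodule.span_induction with
  | mem g hg =>
    obtain ⟨j, rfl⟩ := hg
    have hcirc : ∀ (m : ℕ) θ, diskPow m (circleMap 0 1 θ) = circleMap 0 1 θ ^ m := by
      intro m θ
      exact diskPow_of_norm_le_one (by simp) m
    obtain ⟨m, rfl | rfl⟩ := j.eq_nat_or_neg
    · rcases eq_or_ne m 0 with rfl | hm
      · refine ⟨1, fun θ => ?_, ?_⟩
        · rw [fourier_coe_eq_circleMap_zpow]
          simp
        · simpa using hmass
      · refine ⟨diskPowBCF m, fun θ => ?_, ?_⟩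
        · rw [fourier_coe_eq_circleMap_zpow, zpow_natCast]
          exact hcirc m θ
        · have := hpow m hm
          rwa [← integral_diskPow_circleMeasure hm] at this
    · rcases eq_or_ne m 0 with rfl | hm
      · refine ⟨1, fun θ => ?_, ?_⟩
        · rw [fourier_coe_eq_circleMap_zpow]
          simp
        · simpa using hmass
      · refine ⟨star (diskPowBCF m), fun θ => ?_, ?_⟩
        · rw [fourier_coe_eq_circleMap_zpow, zpow_neg, zpow_natCast, ← inv_pow,
            circleMap_zero_inv]
          have : star (diskPowBCF m) (circleMap 0 1 θ) =
            starRingEnd ℂ (diskPow m (circleMap 0 1 θ)) := rfl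
          rw [this, hcirc, map_pow]
          congr 1
          simp [circleMap, ← Complex.exp_conj]
        · have h1 : ∀ ν : Measure ℂ, ∫ z, star (diskPowBCF m) z ∂ν =
              starRingEnd ℂ (∫ z, diskPow m z ∂ν) := fun ν => integral_conj
          simp only [h1]
          have := hpow m hm
          rw [← integral_diskPow_circleMeasure hm] at this
          exact (Complex.continuous_conj.tendsto _).comp this
  | zero => exact ⟨0, by simp, by simp⟩
  | add g₁ g₂ _ _ h₁ h₂ =>
    obtain ⟨G₁, e₁, t₁⟩ := h₁
    obtain ⟨G₂, e₂, t₂⟩ := h₂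
    refine ⟨G₁ + G₂, fun θ => by simp [e₁, e₂], ?_⟩
    have h : ∀ ν : Measure ℂ, IsFiniteMeasure ν → ∫ z, (G₁ + G₂) z ∂ν =
        ∫ z, G₁ z ∂ν + ∫ z, G₂ z ∂ν := fun ν _ => integral_add (G₁.integrable ν) (G₂.integrable ν)
    rw [h _ inferInstance]
    simp only [h _ inferInstance]
    exact t₁.add t₂
  | smul c g _ h =>
    obtain ⟨G, e, t⟩ := h
    refine ⟨c • G, fun θ => by simp [e], ?_⟩
    simp only [BoundedContinuousFunction.coe_smul, integral_smul]
    exact t.const_smul c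

/-- Total mass at most `1` suffices: since `circleGap ≥ 0`, the two radial limits force the mass to
`1` and the integral of `circleGap` to `0`. This also supplies tightness. -/
theorem tendsto_uniformCircle_of_moments {μ : ℕ → FiniteMeasure ℂ}
    (hmass : ∀ n, ∫ _, (1 : ℝ) ∂(μ n : Measure ℂ) ≤ 1)
    (hout : Tendsto (fun n => ∫ z, radialKernel (Real.exp 1) z ∂(μ n : Measure ℂ)) atTop (𝓝 1))
    (hin : Tendsto (fun n => ∫ z, radialKernel (Real.exp (-1)) z ∂(μ n : Measure ℂ)) atTop (𝓝 0))
    (hpow : ∀ m : ℕ, m ≠ 0 →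
      Tendsto (fun n => ∫ z, diskPow m z ∂(μ n : Measure ℂ)) atTop (𝓝 0)) :
    Tendsto μ atTop (𝓝 uniformCircle.toFiniteMeasure) := by
  have := isProbabilityMeasure_circleMeasure
  have hgap_eq : ∀ n, ∫ z, circleGap z ∂(μ n : Measure ℂ) = ∫ _, (1 : ℝ) ∂(μ n : Measure ℂ) -
      ∫ z, radialKernel (Real.exp 1) z ∂(μ n : Measure ℂ) -
      ∫ z, radialKernel (Real.exp (-1)) z ∂(μ n : Measure ℂ) := by
    intro n
    have i1 := (radialKernelBCF (Real.exp_pos 1)).integrable (μ n : Measure ℂ)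
    have i2 := (radialKernelBCF (Real.exp_pos (-1))).integrable (μ n : Measure ℂ)
    have i0 : Integrable (fun _ : ℂ => (1 : ℝ)) (μ n : Measure ℂ) := integrable_const _
    exact (integral_sub (i0.sub i1) i2).trans (congrArg (· - _) (integral_sub i0 i1))
  have hgap : Tendsto (fun n => ∫ z, circleGap z ∂(μ n : Measure ℂ)) atTop (𝓝 0) := by
    have hup := (tendsto_const_nhds (x := (1 : ℝ))).sub hout |>.sub hin
    rw [sub_self, sub_zero] at hup
    refine tendsto_of_tendsto_of_tendsto_of_le_of_le tendsto_const_nhds hup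
      (fun n => integral_nonneg circleGap_nonneg) fun n => ?_
    simp only
    rw [hgap_eq]
    linarith [hmass n]
  have hmass1 : Tendsto (fun n => ∫ _, (1 : ℂ) ∂(μ n : Measure ℂ)) atTop (𝓝 1) := by
    have h := (hgap.add hout).add hin
    rw [zero_add, add_zero] at h
    have h' : Tendsto (fun n => ∫ _, (1 : ℝ) ∂(μ n : Measure ℂ)) atTop (𝓝 1) :=
      h.congr fun n => by rw [hgap_eq]; ring
    have h'' := (Complex.continuous_ofReal.tendsto 1).comp h'
    refine h''.congr fun n => ?_
    simp
  rw [FiniteMeasure.tendsto_iff_forall_integral_rclike_tendsto ℂ]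
  intro f
  change Tendsto _ _ (𝓝 (∫ z, f z ∂circleMeasure))
  rw [Metric.tendsto_atTop']
  intro ε hε
  -- Four errors arise: approximation on the circle under each measure, the mass away from the
  -- circle, and the convergence of the integrals of `G`.
  have hη : 0 < ε / 5 := by positivity
  let f' : C(AddCircle (2 * Real.pi), ℂ) :=
    ⟨fun x => f (AddCircle.toCircle x : ℂ), by
      have := (AddCircle.continuous_toCircle (T := 2 * Real.pi))
      exact f.continuous.comp (continuous_subtype_val.comp this)⟩
  have hf' : ∀ θ : ℝ, f' θ = f (circleMap 0 1 θ) := by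
    intro θ
    have := fourier_coe_eq_circleMap_zpow 1 θ
    rw [zpow_one, fourier_one] at this
    rw [← this]
    rfl
  have hdense : f' ∈ (Submodule.span ℂ (Set.range (@fourier (2 * Real.pi)))).topologicalClosure := by
    rw [span_fourier_closure_eq_top]
    trivial
  obtain ⟨g, hg, hfg⟩ := Metric.mem_closure_iff.1 hdense (ε / 5) hη
  obtain ⟨G, hG, hGt⟩ := exists_extension_of_mem_span_fourier hmass1 hpow hg
  have hh : ∀ z : ℂ, ‖z‖ = 1 → ‖(f - G) z‖ < ε / 5 := by
    intro z hz
    have hz' : z = circleMap 0 1 z.arg := by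
      rw [circleMap_zero, ← hz]
      exact (Complex.norm_mul_exp_arg_mul_I z).symm
    rw [BoundedContinuousFunction.sub_apply, hz', ← hf', hG, ← dist_eq_norm]
    exact (ContinuousMap.dist_apply_le_dist _).trans_lt hfg
  obtain ⟨C, hC, hCb⟩ := exists_norm_le_add_mul_circleGap (f - G) hη hh
  have hbound : ∀ n, ‖∫ z, (f - G) z ∂(μ n : Measure ℂ)‖ ≤
      ε / 5 + C * ∫ z, circleGap z ∂(μ n : Measure ℂ) := by
    intro n
    have i1 : Integrable (fun _ : ℂ => ε / 5) (μ n : Measure ℂ) := integrable_const _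
    have i2 := (circleGap.integrable (μ n : Measure ℂ)).const_mul C
    refine (norm_integral_le_of_norm_le (i1.add i2) (ae_of_all _ hCb)).trans ?_
    rw [integral_add' i1 i2, integral_const_mul]
    have e : ∫ _, ε / 5 ∂(μ n : Measure ℂ) = ε / 5 * ∫ _, (1 : ℝ) ∂(μ n : Measure ℂ) := by
      rw [← integral_const_mul, mul_one]
    have := mul_le_mul_of_nonneg_left (hmass n) hη.le
    linarith
  have hbound' : ‖∫ z, (f - G) z ∂circleMeasure‖ ≤ ε / 5 := by
    rw [integral_circleMeasure (f - G).continuous, Real.circleAverage_def,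
      ← intervalIntegral.integral_smul]
    refine (intervalIntegral.norm_integral_le_of_norm_le_const
      (C := (2 * Real.pi)⁻¹ * (ε / 5)) fun θ _ => ?_).trans (le_of_eq ?_)
    · rw [norm_smul, Real.norm_of_nonneg (by positivity)]
      gcongr
      exact (hh _ (by simp)).le
    · rw [sub_zero, abs_of_pos Real.two_pi_pos]
      field_simp
  have hCgap : Tendsto (fun n => C * ∫ z, circleGap z ∂(μ n : Measure ℂ)) atTop (𝓝 0) := by
    simpa using hgap.const_mul C
  obtain ⟨N₁, hN₁⟩ := Metric.tendsto_atTop'.1 hGt (ε / 5) hη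
  obtain ⟨N₂, hN₂⟩ := Metric.tendsto_atTop'.1 hCgap (ε / 5) hη
  refine ⟨max N₁ N₂, fun n hn => ?_⟩
  have b1 := hN₁ n ((le_max_left _ _).trans_lt hn)
  have b2 := hN₂ n ((le_max_right _ _).trans_lt hn)
  rw [Real.dist_0_eq_abs] at b2
  have hsub : ∀ ν : Measure ℂ, IsFiniteMeasure ν → ∫ z, f z ∂ν =
      ∫ z, (f - G) z ∂ν + ∫ z, G z ∂ν := by
    intro ν _
    rw [← integral_add ((f - G).integrable ν) (G.integrable ν)]
    simp
  rw [hsub _ inferInstance, hsub circleMeasure inferInstance, dist_eq_norm, add_sub_add_comm]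
  rw [dist_eq_norm] at b1
  refine (norm_add_le _ _).trans_lt ?_
  have b3 := norm_sub_le (∫ z, (f - G) z ∂(μ n : Measure ℂ)) (∫ z, (f - G) z ∂circleMeasure)
  linarith [hbound n, le_abs_self (C * ∫ z, circleGap z ∂(μ n : Measure ℂ))]

/-! ### Sufficiency: coefficients determine the growth of Mahler measures -/

theorem dilate_one (p : ℂ[X]) : dilate p 1 = p := by simp [dilate]

theorem integral_radialKernel_empiricalMeasure {p : ℂ[X]} (hp : p ≠ 0) (n : ℕ) {R : ℝ}
    (hR : 0 < R) : ∫ z, radialKernel R z ∂(empiricalMeasure n p : Measure ℂ) =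
      (n : ℝ)⁻¹ * (Real.log (dilate p R).mahlerMeasure - Real.log p.mahlerMeasure) := by
  rw [integral_empiricalMeasure, log_mahlerMeasure_dilate hp hR, add_sub_cancel_left, smul_eq_mul]

theorem integral_one_empiricalMeasure_le {p : ℂ[X]} {n : ℕ} (hn : p.natDegree ≤ n) :
    ∫ _, (1 : ℝ) ∂(empiricalMeasure n p : Measure ℂ) ≤ 1 := by
  rw [integral_empiricalMeasure]
  simp only [Multiset.map_const', Multiset.sum_replicate, smul_eq_mul, nsmul_eq_mul, mul_one]
  have : (p.roots.card : ℝ) ≤ n := by exact_mod_cast p.card_roots'.trans hn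
  exact inv_mul_le_one_of_le₀ this (by positivity)

/-- One term of `(x + 1) ^ n` gives `C(n,k) ≤ (1 + x)^n x^(-k)`. With `x = δ / 2`, the two factors
cost at most `x n` each in the logarithm once `k |log x| ≤ x n`. -/
theorem exists_log_choose_le {δ : ℝ} (hδ : 0 < δ) :
    ∃ ε, 0 < ε ∧ ∀ n k : ℕ, k ≤ n → (k : ℝ) ≤ ε * n → Real.log (n.choose k) ≤ δ * n := by
  set x := δ / 2 with hx
  have hx0 : 0 < x := by positivity
  have hl : 0 < |Real.log x| + 1 := by positivity
  refine ⟨x / (|Real.log x| + 1), by positivity, fun n k hk hkn => ?_⟩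
  have hc : (0 : ℝ) < n.choose k := by exact_mod_cast Nat.choose_pos hk
  have h1 : x ^ k * n.choose k ≤ (x + 1) ^ n := by
    rw [add_pow]
    have := Finset.single_le_sum (f := fun m => x ^ m * 1 ^ (n - m) * (n.choose m : ℝ))
      (fun m _ => by positivity) (Finset.mem_range.2 (Nat.lt_succ_of_le hk))
    simpa using this
  have h2 := Real.log_le_log (by positivity) h1
  rw [Real.log_mul (by positivity) hc.ne', Real.log_pow, Real.log_pow] at h2
  have h3 : Real.log (x + 1) ≤ x := by
    have := Real.log_le_sub_one_of_pos (show 0 < x + 1 by positivity)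
    linarith
  have h4 : (n : ℝ) * Real.log (x + 1) ≤ n * x := by gcongr
  have h5 : -(k * |Real.log x|) ≤ k * Real.log x := by
    rw [← mul_neg]
    gcongr
    exact neg_abs_le _
  have h6 : k * |Real.log x| ≤ x * n := by
    calc k * |Real.log x| ≤ k * (|Real.log x| + 1) := by gcongr; linarith
      _ ≤ x / (|Real.log x| + 1) * n * (|Real.log x| + 1) := by gcongr
      _ = x * n := by field_simp
  have : δ = x + x := by rw [hx]; ring
  rw [this]
  linarith

theorem exists_max_index (c : ℕ → ℂ) (n : ℕ) (P : ℕ → Prop) (hP : ∃ k ≤ n, P k) :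
    ∃ k ≤ n, P k ∧ ∀ j ≤ n, P j → ‖c j‖ ≤ ‖c k‖ := by
  classical
  obtain ⟨k₀, hk₀, hPk₀⟩ := hP
  obtain ⟨k, hk, hmax⟩ := Finset.exists_max_image ((Finset.range (n + 1)).filter P) (fun k => ‖c k‖)
    ⟨k₀, by simp [hPk₀]; omega⟩
  simp only [Finset.mem_filter, Finset.mem_range, Nat.lt_succ_iff] at hk hmax
  exact ⟨k, hk.1, hk.2, fun j hj hPj => hmax j ⟨hj, hPj⟩⟩

/-- The largest modulus among the coefficients of index at most `n`. -/
noncomputable def maxNormCoeff (p : ℂ[X]) (n : ℕ) : ℝ :=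
  (Finset.range (n + 1)).sup' Finset.nonempty_range_add_one fun k => ‖p.coeff k‖

theorem norm_coeff_le_maxNormCoeff (p : ℂ[X]) {n k : ℕ} (hk : k ≤ n) :
    ‖p.coeff k‖ ≤ maxNormCoeff p n :=
  Finset.le_sup' (fun k => ‖p.coeff k‖) (Finset.mem_range.2 (Nat.lt_succ_of_le hk))

theorem maxNormCoeff_le_iff {p : ℂ[X]} {n : ℕ} {x : ℝ} :
    maxNormCoeff p n ≤ x ↔ ∀ k ≤ n, ‖p.coeff k‖ ≤ x := by
  simp [maxNormCoeff]

theorem maxNormCoeff_pos {p : ℂ[X]} (hp : p ≠ 0) {n : ℕ} (hn : p.natDegree ≤ n) :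
    0 < maxNormCoeff p n :=
  (norm_pos_iff.2 (Polynomial.leadingCoeff_ne_zero.2 hp)).trans_le
    (norm_coeff_le_maxNormCoeff p hn)

theorem log_mahlerMeasure_dilate_le {p : ℂ[X]} (hp : p ≠ 0) {n : ℕ} (hn : p.natDegree ≤ n) {R : ℝ}
    (hR : 0 < R) : Real.log (dilate p R).mahlerMeasure ≤
      Real.log (maxNormCoeff p n) + Real.log (n + 1) + n * Real.log (max 1 R) := by
  have hA := maxNormCoeff_pos hp hn
  have h1 : 0 < max 1 R := lt_max_of_lt_left one_pos
  have hM := Polynomial.mahlerMeasure_pos_of_ne_zero (dilate_ne_zero hp hR)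
  have hle : (dilate p R).mahlerMeasure ≤ maxNormCoeff p n * (n + 1) * max 1 R ^ n := by
    refine (mahlerMeasure_dilate_le hn hR).trans ?_
    refine (Finset.sum_le_card_nsmul _ _ (maxNormCoeff p n * max 1 R ^ n) fun k hk => ?_).trans ?_
    · have hk' : k ≤ n := Nat.lt_succ_iff.1 (Finset.mem_range.1 hk)
      refine mul_le_mul (norm_coeff_le_maxNormCoeff p hk') ?_ (by positivity) hA.le
      calc R ^ k ≤ max 1 R ^ k := by gcongr; exact le_max_right _ _
        _ ≤ max 1 R ^ n := pow_le_pow_right₀ (le_max_left _ _) hk'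
    · rw [Finset.card_range, nsmul_eq_mul]
      push_cast
      exact le_of_eq (by ring)
  have := Real.log_le_log hM hle
  rwa [Real.log_mul (by positivity) (by positivity), Real.log_mul (by positivity) (by positivity),
    Real.log_pow] at this

theorem le_log_mahlerMeasure_dilate {p : ℂ[X]} (hp : p ≠ 0) {n : ℕ} (hn : p.natDegree ≤ n) {R : ℝ}
    (hR : 0 < R) {k : ℕ} (hk : k ≤ n) {s : ℝ} (hA : maxNormCoeff p n ≤ Real.exp s * ‖p.coeff k‖) :
    Real.log (maxNormCoeff p n) - s + k * Real.log R - Real.log (n.choose k) ≤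
      Real.log (dilate p R).mahlerMeasure := by
  have hA0 := maxNormCoeff_pos hp hn
  have hM := Polynomial.mahlerMeasure_pos_of_ne_zero (dilate_ne_zero hp hR)
  have hc : (0 : ℝ) < n.choose k := by exact_mod_cast Nat.choose_pos hk
  have hck : 0 < ‖p.coeff k‖ := pos_of_mul_pos_right (hA0.trans_le hA) (Real.exp_pos _).le
  have h1 := Real.log_le_log (by positivity) (norm_coeff_mul_pow_le hn hR k)
  have h2 := Real.log_le_log hA0 hA
  rw [Real.log_mul (by positivity) (by positivity), Real.log_pow,
    Real.log_mul hc.ne' hM.ne'] at h1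
  rw [Real.log_mul (by positivity) (by positivity), Real.log_exp] at h2
  linarith

theorem tendsto_log_add_one_div : Tendsto (fun n : ℕ => Real.log (n + 1) / n) atTop (𝓝 0) := by
  have h1 : Tendsto (fun n : ℕ => Real.log ((n + 1 : ℕ) : ℝ) / ((n + 1 : ℕ) : ℝ)) atTop (𝓝 0) :=
    ((Real.isLittleO_log_id_atTop.tendsto_div_nhds_zero).comp tendsto_natCast_atTop_atTop).comp
      (tendsto_add_atTop_nat 1)
  have h2 : Tendsto (fun n : ℕ => ((n + 1 : ℕ) : ℝ) / n) atTop (𝓝 1) := by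
    have := tendsto_one_div_atTop_nhds_zero_nat (𝕜 := ℝ) |>.const_add 1
    rw [add_zero] at this
    refine this.congr' ?_
    filter_upwards [eventually_gt_atTop 0] with n hn
    have : (n : ℝ) ≠ 0 := by exact_mod_cast hn.ne'
    push_cast
    field_simp
  have := h1.mul h2
  rw [zero_mul] at this
  refine this.congr fun n => ?_
  have : (n : ℝ) + 1 ≠ 0 := by positivity
  push_cast
  field_simp

/-- The upper bound holds unconditionally by `log_mahlerMeasure_dilate_le`, so only the lower bound
is assumed. -/
theorem tendsto_log_mahlerMeasure_dilate {p : ℕ → ℂ[X]}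
    (hp : ∀ n, 1 ≤ n → p n ≠ 0) (hdeg : ∀ n, (p n).natDegree ≤ n) {R : ℝ} (hR : 0 < R)
    (h : ∀ η > 0, ∀ᶠ n : ℕ in atTop, ((Real.log (max 1 R) - η) * n : ℝ) ≤
      Real.log (dilate (p n) R).mahlerMeasure - Real.log (maxNormCoeff (p n) n)) :
    Tendsto (fun n : ℕ => (n : ℝ)⁻¹ * (Real.log (dilate (p n) R).mahlerMeasure -
      Real.log (maxNormCoeff (p n) n))) atTop (𝓝 (Real.log (max 1 R))) := by
  rw [tendsto_order]
  constructor
  · intro x hx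
    filter_upwards [h ((Real.log (max 1 R) - x) / 2) (by linarith), eventually_gt_atTop 0]
      with n hn hn0
    have hn0' : (0 : ℝ) < n := by exact_mod_cast hn0
    rw [inv_mul_eq_div, lt_div_iff₀ hn0']
    refine lt_of_lt_of_le ?_ hn
    gcongr
    linarith
  · intro x hx
    have := (tendsto_order.1 tendsto_log_add_one_div).2 (x - Real.log (max 1 R)) (by linarith)
    filter_upwards [this, eventually_gt_atTop 0] with n hn hn0
    have hn0' : (0 : ℝ) < n := by exact_mod_cast hn0
    have := log_mahlerMeasure_dilate_le (hp n hn0) (hdeg n) hR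
    rw [inv_mul_eq_div, div_lt_iff₀ hn0']
    rw [div_lt_iff₀ hn0'] at hn
    linarith

theorem tendsto_log_mahlerMeasure_dilate_of_le_one {p : ℕ → ℂ[X]}
    (hp : ∀ n, 1 ≤ n → p n ≠ 0) (hdeg : ∀ n, (p n).natDegree ≤ n) {R : ℝ} (hR : 0 < R) (hR1 : R ≤ 1)
    (hlow : ∀ ε : ℝ, 0 < ε → ∃ N : ℕ, ∀ n : ℕ, N < n → ∃ k ≤ n, (k : ℝ) ≤ ε * n ∧
      maxNormCoeff (p n) n ≤ Real.exp (ε * n) * ‖(p n).coeff k‖) :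
    Tendsto (fun n : ℕ => (n : ℝ)⁻¹ * (Real.log (dilate (p n) R).mahlerMeasure -
      Real.log (maxNormCoeff (p n) n))) atTop (𝓝 0) := by
  have key := tendsto_log_mahlerMeasure_dilate hp hdeg hR ?_
  · rwa [max_eq_left hR1, Real.log_one] at key
  intro η hη
  have hl : Real.log R ≤ 0 := Real.log_nonpos hR.le hR1
  have hl' : 0 < 1 - Real.log R := by linarith
  obtain ⟨ε₀, hε₀, hch⟩ := exists_log_choose_le (half_pos hη)
  -- Half of `η` pays for the binomial coefficient; the other half pays for `exp (ε n)` and for `R ^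
  -- k` with `k ≤ ε n`.
  obtain ⟨N, hN⟩ := hlow (min ε₀ (η / 2 / (1 - Real.log R))) (by positivity)
  set ε := min ε₀ (η / 2 / (1 - Real.log R))
  have hε : ε * (1 - Real.log R) ≤ η / 2 :=
    (le_div_iff₀ hl').1 (min_le_right _ _)
  filter_upwards [eventually_gt_atTop N, eventually_gt_atTop 0] with n hn hn0
  obtain ⟨k, hk, hkε, hA⟩ := hN n hn
  have h1 := le_log_mahlerMeasure_dilate (hp n hn0) (hdeg n) hR hk hA
  have h2 := hch n k hk (hkε.trans (by gcongr; exact min_le_left _ _))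
  have h3 : ε * n * Real.log R ≤ k * Real.log R := mul_le_mul_of_nonpos_right hkε hl
  have h4 : ε * (1 - Real.log R) * n ≤ η / 2 * n := by gcongr
  rw [max_eq_left hR1, Real.log_one]
  linarith

theorem tendsto_log_mahlerMeasure_dilate_of_one_le {p : ℕ → ℂ[X]}
    (hp : ∀ n, 1 ≤ n → p n ≠ 0) (hdeg : ∀ n, (p n).natDegree ≤ n) {R : ℝ} (hR1 : 1 ≤ R)
    (hhigh : ∀ ε : ℝ, 0 < ε → ∃ N : ℕ, ∀ n : ℕ, N < n → ∃ k ≤ n, (1 - ε) * n ≤ (k : ℝ) ∧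
      maxNormCoeff (p n) n ≤ Real.exp (ε * n) * ‖(p n).coeff k‖) :
    Tendsto (fun n : ℕ => (n : ℝ)⁻¹ * (Real.log (dilate (p n) R).mahlerMeasure -
      Real.log (maxNormCoeff (p n) n))) atTop (𝓝 (Real.log R)) := by
  have hR : 0 < R := one_pos.trans_le hR1
  have key := tendsto_log_mahlerMeasure_dilate hp hdeg hR ?_
  · rwa [max_eq_right hR1] at key
  intro η hη
  have hl : 0 ≤ Real.log R := Real.log_nonneg hR1
  have hl' : 0 < 1 + Real.log R := by linarith
  obtain ⟨ε₀, hε₀, hch⟩ := exists_log_choose_le (half_pos hη)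
  obtain ⟨N, hN⟩ := hhigh (min ε₀ (η / 2 / (1 + Real.log R))) (by positivity)
  set ε := min ε₀ (η / 2 / (1 + Real.log R))
  have hε : ε * (1 + Real.log R) ≤ η / 2 :=
    (le_div_iff₀ hl').1 (min_le_right _ _)
  filter_upwards [eventually_gt_atTop N, eventually_gt_atTop 0] with n hn hn0
  obtain ⟨k, hk, hkε, hA⟩ := hN n hn
  have h1 := le_log_mahlerMeasure_dilate (hp n hn0) (hdeg n) hR hk hA
  have hε₀' : ε * n ≤ ε₀ * n := by gcongr; exact min_le_left _ _
  have h2 := hch n (n - k) (Nat.sub_le _ _) (by rw [Nat.cast_sub hk]; linarith)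
  -- Symmetry of binomial coefficients transfers the small-index estimate to indices near `n`.
  rw [Nat.choose_symm hk] at h2
  have h3 : (1 - ε) * n * Real.log R ≤ k * Real.log R := by gcongr
  have h4 : ε * (1 + Real.log R) * n ≤ η / 2 * n := by gcongr
  rw [max_eq_right hR1]
  linarith

theorem tendsto_empiricalMeasure_uniformCircle {p : ℕ → ℂ[X]}
    (hp : ∀ n, 1 ≤ n → p n ≠ 0) (hdeg : ∀ n, (p n).natDegree ≤ n)
    (hlow : ∀ ε : ℝ, 0 < ε → ∃ N : ℕ, ∀ n : ℕ, N < n → ∃ k ≤ n, (k : ℝ) ≤ ε * n ∧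
      maxNormCoeff (p n) n ≤ Real.exp (ε * n) * ‖(p n).coeff k‖)
    (hhigh : ∀ ε : ℝ, 0 < ε → ∃ N : ℕ, ∀ n : ℕ, N < n → ∃ k ≤ n, (1 - ε) * n ≤ (k : ℝ) ∧
      maxNormCoeff (p n) n ≤ Real.exp (ε * n) * ‖(p n).coeff k‖) :
    Tendsto (fun n => empiricalMeasure n (p n)) atTop (𝓝 uniformCircle.toFiniteMeasure) := by
  -- `R = 1` replaces `log A` by `log M(p)` up to `o(n)`; either end condition would give it.
  have t1 := tendsto_log_mahlerMeasure_dilate_of_le_one hp hdeg one_pos le_rfl hlow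
  simp only [dilate_one] at t1
  have tin := tendsto_log_mahlerMeasure_dilate_of_le_one hp hdeg (Real.exp_pos (-1))
    (Real.exp_le_one_iff.2 (by norm_num)) hlow
  have tout := tendsto_log_mahlerMeasure_dilate_of_one_le hp hdeg
    (Real.one_le_exp zero_le_one) hhigh
  have hK : ∀ {R : ℝ}, 0 < R → ∀ {L : ℝ}, Tendsto (fun n : ℕ => (n : ℝ)⁻¹ *
      (Real.log (dilate (p n) R).mahlerMeasure - Real.log (maxNormCoeff (p n) n))) atTop (𝓝 L) →
      Tendsto (fun n => ∫ z, radialKernel R z ∂(empiricalMeasure n (p n) : Measure ℂ)) atTop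
        (𝓝 L) := by
    intro R hR L hL
    have := hL.sub t1
    rw [sub_zero] at this
    refine this.congr' ?_
    filter_upwards [eventually_gt_atTop 0] with n hn
    rw [integral_radialKernel_empiricalMeasure (hp n hn) n hR]
    ring
  refine tendsto_uniformCircle_of_moments (fun n => integral_one_empiricalMeasure_le (hdeg n))
    ?_ (hK (Real.exp_pos _) tin) fun m hm => ?_
  · have := hK (Real.exp_pos _) tout
    rwa [Real.log_exp] at this
  · have hb : Tendsto (fun n : ℕ => 2 * m * (2 * (Real.log (n + 1) / n) - (n : ℝ)⁻¹ *
        (Real.log (p n).mahlerMeasure - Real.log (maxNormCoeff (p n) n)))) atTop (𝓝 0) := by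
      simpa using ((tendsto_log_add_one_div.const_mul 2).sub t1).const_mul (2 * (m : ℝ))
    refine squeeze_zero_norm' ?_ hb
    filter_upwards [eventually_gt_atTop 0] with n hn
    have hA := maxNormCoeff_pos (hp n hn) (hdeg n)
    have hlog : 0 ≤ Real.log ((n : ℝ) + 1) := Real.log_nonneg (by simp)
    have hbd := norm_sum_diskPow_le (hp n hn) hm (c := Real.log (maxNormCoeff (p n) n)) hlog ?_
    · rw [integral_empiricalMeasure, norm_smul, Real.norm_of_nonneg (by positivity)]
      refine (mul_le_mul_of_nonneg_left hbd (by positivity)).trans (le_of_eq ?_)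
      ring
    · intro z hz h0
      have hz1 : ‖z‖ = 1 := by simpa using hz
      rw [← Real.log_mul hA.ne' (by positivity)]
      refine Real.log_le_log (norm_pos_iff.2 h0) ?_
      rw [Polynomial.eval_eq_sum_range' (Nat.lt_succ_of_le (hdeg n))]
      refine (norm_sum_le_of_le (f := fun i => (p n).coeff i * z ^ i) _
        (n := fun _ => maxNormCoeff (p n) n) fun k hk => ?_).trans ?_
      · rw [norm_mul, norm_pow, hz1, one_pow, mul_one]
        exact norm_coeff_le_maxNormCoeff _ (Nat.lt_succ_iff.1 (Finset.mem_range.1 hk))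
      · rw [Finset.sum_const, Finset.card_range, nsmul_eq_mul]
        push_cast
        exact le_of_eq (by ring)

/-! ### Necessity: weak convergence controls the coefficients -/

/-- The logarithmic kernel `log |z - w|`, truncated from below at `log δ` and normalized by
`log max(1, |w|)`. -/
noncomputable def truncKernel (δ : ℝ) (z w : ℂ) : ℝ :=
  Real.log (max δ ‖z - w‖) - Real.log (max 1 ‖w‖)

theorem continuous_truncKernel {δ : ℝ} (hδ : 0 < δ) (z : ℂ) : Continuous (truncKernel δ z) := by
  unfold truncKernel
  refine (Continuous.log (by fun_prop) fun w => ?_).sub (Continuous.log (by fun_prop) fun w => ?_)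
  · exact (lt_max_of_lt_left hδ).ne'
  · exact (lt_max_of_lt_left one_pos).ne'

/-- Truncation removes the pole and normalization the growth at infinity, so the kernel is an
admissible test function. -/
theorem abs_truncKernel_le {δ : ℝ} (hδ : 0 < δ) (hδ1 : δ ≤ 1) {z : ℂ} (hz : ‖z‖ = 1) (w : ℂ) :
    |truncKernel δ z w| ≤ Real.log (2 / δ) := by
  have h1 : 0 < max 1 ‖w‖ := lt_max_of_lt_left one_pos
  have h2 : 0 < max δ ‖z - w‖ := lt_max_of_lt_left hδ
  have up : max δ ‖z - w‖ ≤ 2 / δ * max 1 ‖w‖ := by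
    have h2δ : 2 ≤ 2 / δ := by rw [le_div_iff₀ hδ]; linarith
    have hb : max δ ‖z - w‖ ≤ 2 * max 1 ‖w‖ := by
      refine max_le (by linarith [le_max_left 1 ‖w‖]) ((norm_sub_le _ _).trans ?_)
      rw [hz]
      linarith [le_max_left 1 ‖w‖, le_max_right 1 ‖w‖]
    exact hb.trans (by gcongr)
  have lo : max 1 ‖w‖ ≤ 2 / δ * max δ ‖z - w‖ := by
    rw [div_mul_eq_mul_div, le_div_iff₀ hδ]
    rcases le_total ‖w‖ 2 with h | h
    · have : max 1 ‖w‖ ≤ 2 := max_le (by norm_num) h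
      nlinarith [le_max_left δ ‖z - w‖]
    · have := norm_sub_norm_le w z
      rw [norm_sub_rev, hz] at this
      rw [max_eq_right (by linarith)]
      nlinarith [le_max_right δ ‖z - w‖, norm_nonneg w]
  have l1 := Real.log_le_log h2 up
  have l2 := Real.log_le_log h1 lo
  rw [Real.log_mul (by positivity) h1.ne'] at l1
  rw [Real.log_mul (by positivity) h2.ne'] at l2
  rw [truncKernel, abs_le]
  constructor <;> linarith

/-- Uniformity in `w` lets an estimate at one point `z₀` spread to a ball independent of `n`. -/
theorem truncKernel_le_add {δ : ℝ} (hδ : 0 < δ) (z z₀ w : ℂ) :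
    truncKernel δ z w ≤ truncKernel δ z₀ w + ‖z - z₀‖ / δ := by
  have hx : 0 < max δ ‖z - w‖ := lt_max_of_lt_left hδ
  have hy : 0 < max δ ‖z₀ - w‖ := lt_max_of_lt_left hδ
  have h1 := Real.log_le_sub_one_of_pos (div_pos hx hy)
  rw [Real.log_div hx.ne' hy.ne'] at h1
  have h2 : max δ ‖z - w‖ ≤ max δ ‖z₀ - w‖ + ‖z - z₀‖ := by
    refine max_le (by linarith [le_max_left δ ‖z₀ - w‖, norm_nonneg (z - z₀)]) ?_
    have := norm_sub_le_norm_sub_add_norm_sub z z₀ w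
    linarith [le_max_right δ ‖z₀ - w‖]
  have h3 : max δ ‖z - w‖ / max δ ‖z₀ - w‖ - 1 ≤ ‖z - z₀‖ / δ := by
    rw [div_sub_one hy.ne']
    refine (div_le_div_of_nonneg_right (by linarith) hy.le).trans ?_
    exact div_le_div_of_nonneg_left (norm_nonneg _) hδ (le_max_left _ _)
  unfold truncKernel
  linarith

/-- The untruncated average is zero for `z` on the circle, and dominated convergence applies as `δ ↓
0`. -/
theorem exists_circleAverage_log_max_lt {z : ℂ} (hz : ‖z‖ = 1) {η : ℝ} (hη : 0 < η) :
    ∃ δ, 0 < δ ∧ δ ≤ 1 ∧ Real.circleAverage (fun w => Real.log (max δ ‖z - w‖)) 0 1 < η := by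
  have hlim : Tendsto (fun δ => Real.circleAverage (fun w => Real.log (max δ ‖z - w‖)) 0 1)
      (𝓝[>] 0) (𝓝 0) := by
    have h0 : Real.circleAverage (fun w => Real.log ‖w - z‖) 0 1 = 0 :=
      circleAverage_log_norm_sub_const₁ hz
    suffices Tendsto (fun δ => Real.circleAverage (fun w => Real.log (max δ ‖z - w‖)) 0 1)
        (𝓝[>] 0) (𝓝 (Real.circleAverage (fun w => Real.log ‖w - z‖) 0 1)) by rwa [h0] at this
    simp only [Real.circleAverage_def]
    refine Tendsto.const_smul ?_ _
    have hint : IntervalIntegrable (fun θ => |Real.log ‖circleMap 0 1 θ - z‖|) volume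
        0 (2 * Real.pi) := by
      have h : CircleIntegrable (fun w => Real.log ‖w - z‖) 0 1 :=
        circleIntegrable_log_norm_sub_const 1
      exact IntervalIntegrable.abs h
    refine intervalIntegral.tendsto_integral_filter_of_dominated_convergence _ ?_ ?_ hint ?_
    · filter_upwards [self_mem_nhdsWithin] with δ hδ
      refine Continuous.aestronglyMeasurable (Continuous.log (by fun_prop) fun θ => ?_)
      exact (lt_max_of_lt_left hδ).ne'
    · filter_upwards [Ioo_mem_nhdsGT (zero_lt_one (α := ℝ))] with δ hδ
      filter_upwards [ae_circleMap_notMem (Set.countable_singleton z)] with θ hθ _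
      rw [norm_sub_rev z]
      have hpos : 0 < ‖circleMap 0 1 θ - z‖ := norm_pos_iff.2 (sub_ne_zero.2 hθ)
      rcases le_total δ ‖circleMap 0 1 θ - z‖ with h | h
      · rw [max_eq_right h, Real.norm_eq_abs]
      · have l1 := Real.log_le_log hpos h
        have l2 := Real.log_nonpos hδ.1.le hδ.2.le
        rw [max_eq_left h, Real.norm_eq_abs, abs_of_nonpos l2, abs_of_nonpos (l1.trans l2)]
        linarith
    · filter_upwards [ae_circleMap_notMem (Set.countable_singleton z)] with θ hθ _
      have hpos : 0 < ‖circleMap 0 1 θ - z‖ := norm_pos_iff.2 (sub_ne_zero.2 hθ)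
      refine tendsto_const_nhds.congr' ?_
      filter_upwards [Ioo_mem_nhdsGT hpos] with δ hδ
      rw [norm_sub_rev z, max_eq_right hδ.2.le]
  have h1 := (tendsto_order.1 hlim).2 η hη
  obtain ⟨δ, h, hδ⟩ := (h1.and (Ioo_mem_nhdsGT (zero_lt_one (α := ℝ)))).exists
  exact ⟨δ, hδ.1, hδ.2.le, h⟩

theorem norm_eval_le_mahlerMeasure_mul_exp (p : ℂ[X]) {δ : ℝ} (hδ : 0 < δ) (z : ℂ) :
    ‖p.eval z‖ ≤ p.mahlerMeasure * Real.exp (p.roots.map (truncKernel δ z)).sum := by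
  rw [norm_eval_eq_prod_roots, Polynomial.mahlerMeasure_eq_leadingCoeff_mul_prod_roots, mul_assoc]
  gcongr
  induction p.roots using Multiset.induction_on with
  | empty => simp
  | cons a s ih =>
    have h1 : 0 < max 1 ‖a‖ := lt_max_of_lt_left one_pos
    have h2 : 0 < max δ ‖z - a‖ := lt_max_of_lt_left hδ
    simp only [Multiset.map_cons, Multiset.prod_cons, Multiset.sum_cons, Real.exp_add]
    have e : max 1 ‖a‖ * Real.exp (truncKernel δ z a) = max δ ‖z - a‖ := by
      rw [truncKernel, Real.exp_sub, Real.exp_log h2, Real.exp_log h1]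
      field_simp
    rw [mul_mul_mul_comm, e]
    refine mul_le_mul (le_max_right _ _) ih ?_ h2.le
    refine Multiset.prod_nonneg fun x hx => ?_
    obtain ⟨w, _, rfl⟩ := Multiset.mem_map.1 hx
    exact norm_nonneg _

/-- Near each `z₀` half of `η` covers the limiting integral of the truncated kernel and half its
variation in `z`. Compactness of the circle makes the threshold in `n` uniform. -/
theorem eventually_norm_eval_le {p : ℕ → ℂ[X]} (hdeg : ∀ n, (p n).natDegree ≤ n)
    (h : Tendsto (fun n => empiricalMeasure n (p n)) atTop (𝓝 uniformCircle.toFiniteMeasure))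
    {η : ℝ} (hη : 0 < η) :
    ∀ᶠ n : ℕ in atTop, ∀ z ∈ Metric.sphere (0 : ℂ) 1,
      ‖(p n).eval z‖ ≤ (p n).mahlerMeasure * Real.exp (η * n) := by
  have hη2 : 0 < η / 2 := half_pos hη
  have key : ∀ z₀ ∈ Metric.sphere (0 : ℂ) 1, ∃ r > 0, ∀ᶠ n : ℕ in atTop,
      ∀ z ∈ Metric.ball z₀ r, ‖(p n).eval z‖ ≤ (p n).mahlerMeasure * Real.exp (η * n) := by
    intro z₀ hz₀
    have hz1 : ‖z₀‖ = 1 := by simpa using hz₀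
    obtain ⟨δ, hδ, hδ1, hav⟩ := exists_circleAverage_log_max_lt hz1 hη2
    let F : ℂ →ᵇ ℝ := BoundedContinuousFunction.ofNormedAddCommGroup (truncKernel δ z₀)
      (continuous_truncKernel hδ z₀) _ (abs_truncKernel_le hδ hδ1 hz1)
    have ht : Tendsto (fun n => ∫ w, truncKernel δ z₀ w ∂(empiricalMeasure n (p n) : Measure ℂ))
        atTop (𝓝 (∫ w, truncKernel δ z₀ w ∂circleMeasure)) :=
      FiniteMeasure.tendsto_iff_forall_integral_tendsto.1 h F
    have hlt : ∫ w, truncKernel δ z₀ w ∂circleMeasure < η / 2 := by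
      rw [integral_circleMeasure (continuous_truncKernel hδ z₀)]
      refine lt_of_eq_of_lt (Real.circleAverage_congr_sphere fun w hw => ?_) hav
      have hw1 : ‖w‖ = 1 := by simpa using hw
      simp [truncKernel, hw1]
    refine ⟨η / 2 * δ, by positivity, ?_⟩
    filter_upwards [(tendsto_order.1 ht).2 _ hlt, eventually_gt_atTop 0] with n hn hn0 z hz
    have hn0' : (0 : ℝ) < n := by exact_mod_cast hn0
    refine (norm_eval_le_mahlerMeasure_mul_exp (p n) hδ z).trans ?_
    have := Polynomial.mahlerMeasure_nonneg (p n)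
    gcongr
    rw [integral_empiricalMeasure, smul_eq_mul, inv_mul_eq_div, div_lt_iff₀ hn0'] at hn
    have hdist : ‖z - z₀‖ / δ ≤ η / 2 := by
      rw [div_le_iff₀ hδ, ← dist_eq_norm]
      exact (Metric.mem_ball.1 hz).le
    calc ((p n).roots.map (truncKernel δ z)).sum
        ≤ ((p n).roots.map fun w => truncKernel δ z₀ w + η / 2).sum :=
          Multiset.sum_map_le_sum_map _ _ fun w _ =>
            (truncKernel_le_add hδ z z₀ w).trans (by gcongr)
      _ = ((p n).roots.map (truncKernel δ z₀)).sum + (p n).roots.card * (η / 2) := by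
          rw [Multiset.sum_map_add, Multiset.map_const', Multiset.sum_replicate, nsmul_eq_mul]
      _ ≤ η / 2 * n + n * (η / 2) := by
          have : ((p n).roots.card : ℝ) ≤ n := by exact_mod_cast (p n).card_roots'.trans (hdeg n)
          gcongr
      _ = η * n := by ring
  choose! r hr hev using key
  obtain ⟨t, hts, htc⟩ := (isCompact_sphere (0 : ℂ) 1).elim_nhds_subcover
    (fun z => Metric.ball z (r z)) fun z hz => Metric.ball_mem_nhds z (hr z hz)
  filter_upwards [(eventually_all_finset t).2 fun z hz => hev z (hts z hz)] with n hn z hz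
  obtain ⟨z₀, hz₀, hzz₀⟩ := Set.mem_iUnion₂.1 (htc hz)
  exact hn z₀ hz₀ z hzz₀

/-- By Parseval, `∑ ‖a_k‖²` is the mean of `‖p‖²` on the circle. -/
theorem norm_coeff_le_of_forall_norm_eval_le (p : ℂ[X]) {C : ℝ} (hC : 0 ≤ C)
    (h : ∀ z ∈ Metric.sphere (0 : ℂ) 1, ‖p.eval z‖ ≤ C) (k : ℕ) : ‖p.coeff k‖ ≤ C := by
  by_cases hk : k ∈ p.support
  · have h1 : ‖p.coeff k‖ ^ 2 ≤ ∑ i ∈ p.support, ‖p.coeff i‖ ^ 2 :=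
      Finset.single_le_sum (f := fun i => ‖p.coeff i‖ ^ 2) (fun i _ => by positivity) hk
    rw [Polynomial.sum_sq_norm_coeff_eq_circleAverage] at h1
    have h2 : Real.circleAverage (fun z => ‖p.eval z‖ ^ 2) 0 1 ≤ C ^ 2 := by
      refine Real.circleAverage_mono_on_of_le_circle ?_ fun z hz => ?_
      · refine ContinuousOn.circleIntegrable zero_le_one (Continuous.continuousOn ?_)
        exact (p.continuous.norm).pow 2
      · have := h z (by simpa using hz)
        gcongr
    exact (sq_le_sq₀ (norm_nonneg _) hC).1 (h1.trans h2)
  · rw [Polynomial.notMem_support_iff.1 hk, norm_zero]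
    exact hC

theorem eventually_two_mul_add_one_le_exp {ε : ℝ} (hε : 0 < ε) :
    ∀ᶠ n : ℕ in atTop, 2 * ((n : ℝ) + 1) ≤ Real.exp (ε * n) := by
  have h1 := (tendsto_order.1 tendsto_log_add_one_div).2 (ε / 2) (by positivity)
  have h2 := (tendsto_natCast_atTop_atTop (R := ℝ)).eventually_ge_atTop (Real.log 2 / (ε / 2))
  filter_upwards [h1, h2, eventually_gt_atTop 0] with n hn1 hn2 hn0
  have hn0' : (0 : ℝ) < n := by exact_mod_cast hn0
  rw [div_lt_iff₀ hn0'] at hn1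
  rw [div_le_iff₀ (by positivity)] at hn2
  rw [← Real.log_le_iff_le_exp (by positivity), Real.log_mul two_ne_zero (by positivity)]
  linarith

/-- The second term on the right of `h` is at most half of the left side and is absorbed. -/
theorem le_exp_mul_of_le_add {A B t N : ℝ} (hA : 0 ≤ A) (hN : 2 * N ≤ Real.exp t)
    (hB : 0 ≤ B) (h : A * Real.exp (-t) ≤ N * (B + A * Real.exp (-(2 * t)))) :
    A ≤ Real.exp (2 * t) * B := by
  have he : Real.exp (-(2 * t)) = Real.exp (-t) * (Real.exp t)⁻¹ := by
    rw [← Real.exp_neg, ← Real.exp_add]; ring_nf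
  have he2 : Real.exp (2 * t) = Real.exp t * Real.exp t := by
    rw [← Real.exp_add]; ring_nf
  have hx := Real.exp_pos t
  rw [he, Real.exp_neg] at h
  rw [he2]
  set x := Real.exp t
  have h1 : N * (A * (x⁻¹ * x⁻¹)) ≤ A * x⁻¹ / 2 := by
    have : N * x⁻¹ ≤ 1 / 2 := by
      rw [← div_eq_mul_inv, div_le_iff₀ hx]
      linarith
    calc N * (A * (x⁻¹ * x⁻¹)) = N * x⁻¹ * (A * x⁻¹) := by ring
      _ ≤ 1 / 2 * (A * x⁻¹) := by gcongr
      _ = A * x⁻¹ / 2 := by ring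
  have h2 : A * x⁻¹ ≤ 2 * N * B := by linarith
  have h3 : A * x⁻¹ ≤ x * B := h2.trans (by gcongr)
  rw [← div_eq_mul_inv, div_le_iff₀ hx] at h3
  linarith

/-- Here `exp s` bounds the weights `R ^ k`, and indices outside `P` lose a further `exp (-ε n)`.
They are too light to account for `M(p_R)`, so the largest coefficient in `P` must. The cases used
are `R = 1/e`, `s = 0` and `R = e`, `s = n`. -/
theorem exists_coeff_of_mahlerMeasure_dilate {p : ℂ[X]} {n : ℕ} (hn : p.natDegree ≤ n)
    {R s ε : ℝ} (hR : 0 < R) (P : ℕ → Prop) (hP : ∃ k ≤ n, P k)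
    (hPs : ∀ k ≤ n, R ^ k ≤ Real.exp s)
    (hPn : ∀ k ≤ n, ¬ P k → R ^ k ≤ Real.exp s * Real.exp (-(ε * n)))
    (hA : maxNormCoeff p n ≤ p.mahlerMeasure * Real.exp (ε / 4 * n))
    (hM : p.mahlerMeasure * Real.exp (s - ε / 4 * n) ≤ (dilate p R).mahlerMeasure)
    (hexp : 2 * ((n : ℝ) + 1) ≤ Real.exp (ε / 2 * n)) :
    ∃ k ≤ n, P k ∧ maxNormCoeff p n ≤ Real.exp (ε * n) * ‖p.coeff k‖ := by
  obtain ⟨k, hk, hPk, hmax⟩ := exists_max_index p.coeff n P hP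
  refine ⟨k, hk, hPk, ?_⟩
  have hA0 : 0 ≤ maxNormCoeff p n :=
    (norm_nonneg _).trans (norm_coeff_le_maxNormCoeff p hk)
  have hsum : (dilate p R).mahlerMeasure ≤ ((n : ℝ) + 1) *
      (Real.exp s * (‖p.coeff k‖ + maxNormCoeff p n * Real.exp (-(ε * n)))) := by
    refine (mahlerMeasure_dilate_le hn hR).trans ((Finset.sum_le_card_nsmul _ _
      (Real.exp s * (‖p.coeff k‖ + maxNormCoeff p n * Real.exp (-(ε * n)))) fun j hj => ?_).trans
      (le_of_eq (by simp)))
    have hj' : j ≤ n := Nat.lt_succ_iff.1 (Finset.mem_range.1 hj)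
    by_cases hPj : P j
    · calc ‖p.coeff j‖ * R ^ j ≤ ‖p.coeff k‖ * Real.exp s :=
            mul_le_mul (hmax j hj' hPj) (hPs j hj') (by positivity) (norm_nonneg _)
        _ ≤ _ := by
            rw [mul_comm]
            gcongr
            exact le_add_of_nonneg_right (by positivity)
    · calc ‖p.coeff j‖ * R ^ j ≤ maxNormCoeff p n * (Real.exp s * Real.exp (-(ε * n))) :=
            mul_le_mul (norm_coeff_le_maxNormCoeff p hj') (hPn j hj' hPj) (by positivity) hA0
        _ = Real.exp s * (maxNormCoeff p n * Real.exp (-(ε * n))) := by ring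
        _ ≤ _ := by
            gcongr
            exact le_add_of_nonneg_left (norm_nonneg _)
  have e1 : Real.exp (ε * n) = Real.exp (2 * (ε / 2 * n)) := by congr 1; ring
  have e2 : Real.exp (-(ε * n)) = Real.exp (-(2 * (ε / 2 * n))) := by congr 1; ring
  rw [e1]
  rw [e2] at hsum
  refine le_exp_mul_of_le_add hA0 hexp (norm_nonneg _) ?_
  have h1 : maxNormCoeff p n * Real.exp (-(ε / 2 * n)) * Real.exp s ≤
      p.mahlerMeasure * Real.exp (s - ε / 4 * n) := by
    calc maxNormCoeff p n * Real.exp (-(ε / 2 * n)) * Real.exp s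
        ≤ p.mahlerMeasure * Real.exp (ε / 4 * n) * Real.exp (-(ε / 2 * n)) * Real.exp s := by
          gcongr
      _ = p.mahlerMeasure * Real.exp (s - ε / 4 * n) := by
          rw [mul_assoc, mul_assoc, ← Real.exp_add, ← Real.exp_add]
          congr 2
          ring
  have h2 := (h1.trans hM).trans hsum
  have hs := Real.exp_pos s
  refine le_of_mul_le_mul_right (h2.trans (le_of_eq ?_)) hs
  ring

theorem eventually_le_mahlerMeasure_dilate {p : ℕ → ℂ[X]} (hp : ∀ n, 1 ≤ n → p n ≠ 0)
    (h : Tendsto (fun n => empiricalMeasure n (p n)) atTop (𝓝 uniformCircle.toFiniteMeasure))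
    {R η : ℝ} (hR : 0 < R) (hη : 0 < η) :
    ∀ᶠ n : ℕ in atTop, (p n).mahlerMeasure * Real.exp (Real.log (max R 1) * n - η * n) ≤
      (dilate (p n) R).mahlerMeasure := by
  have ht : Tendsto (fun n => ∫ w, radialKernel R w ∂(empiricalMeasure n (p n) : Measure ℂ))
      atTop (𝓝 (∫ w, radialKernel R w ∂circleMeasure)) :=
    FiniteMeasure.tendsto_iff_forall_integral_tendsto.1 h (radialKernelBCF hR)
  have hint : ∫ w, radialKernel R w ∂circleMeasure = Real.log (max R 1) := by
    rw [integral_circleMeasure (continuous_radialKernel hR)]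
    refine Real.circleAverage_const_on_circle fun w hw => ?_
    have hw1 : ‖w‖ = 1 := by simpa using hw
    simp [radialKernel, hw1]
  rw [hint] at ht
  filter_upwards [(tendsto_order.1 ht).1 (Real.log (max R 1) - η) (by linarith),
    eventually_gt_atTop 0] with n hn hn0
  have hn0' : (0 : ℝ) < n := by exact_mod_cast hn0
  have hM := Polynomial.mahlerMeasure_pos_of_ne_zero (hp n hn0)
  have hMR := Polynomial.mahlerMeasure_pos_of_ne_zero (dilate_ne_zero (hp n hn0) hR)
  rw [integral_radialKernel_empiricalMeasure (hp n hn0) n hR, inv_mul_eq_div, lt_div_iff₀ hn0']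
    at hn
  rw [← Real.log_le_log_iff (by positivity) hMR, Real.log_mul hM.ne' (Real.exp_pos _).ne',
    Real.log_exp]
  linarith

theorem eventually_coeff_conditions {p : ℕ → ℂ[X]} (hp : ∀ n, 1 ≤ n → p n ≠ 0)
    (hdeg : ∀ n, (p n).natDegree ≤ n)
    (h : Tendsto (fun n => empiricalMeasure n (p n)) atTop (𝓝 uniformCircle.toFiniteMeasure))
    {ε : ℝ} (hε : 0 < ε) :
    ∀ᶠ n : ℕ in atTop,
      (∃ k ≤ n, (k : ℝ) ≤ ε * n ∧
        maxNormCoeff (p n) n ≤ Real.exp (ε * n) * ‖(p n).coeff k‖) ∧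
      ∃ k ≤ n, (1 - ε) * n ≤ (k : ℝ) ∧
        maxNormCoeff (p n) n ≤ Real.exp (ε * n) * ‖(p n).coeff k‖ := by
  -- Two losses of `exp (ε n / 4)`, from `A` against `M(p)` and from `M(p)` against `M(p_R)`, leave
  -- `exp (ε n / 2)` for the factor `n + 1`.
  have hε4 : 0 < ε / 4 := by positivity
  filter_upwards [eventually_norm_eval_le hdeg h hε4,
    eventually_le_mahlerMeasure_dilate hp h (Real.exp_pos (-1)) hε4,
    eventually_le_mahlerMeasure_dilate hp h (Real.exp_pos 1) hε4,
    eventually_two_mul_add_one_le_exp (half_pos hε)] with n hev hin hout hexp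
  have hA : maxNormCoeff (p n) n ≤ (p n).mahlerMeasure * Real.exp (ε / 4 * n) :=
    maxNormCoeff_le_iff.2 fun k _ => norm_coeff_le_of_forall_norm_eval_le (p n)
      (mul_nonneg (p n).mahlerMeasure_nonneg (Real.exp_pos _).le) hev k
  rw [max_eq_right (Real.exp_le_one_iff.2 (by norm_num)), Real.log_one, zero_mul] at hin
  rw [max_eq_left (Real.one_le_exp zero_le_one), Real.log_exp, one_mul] at hout
  refine ⟨exists_coeff_of_mahlerMeasure_dilate (hdeg n) (Real.exp_pos (-1)) _
    ⟨0, Nat.zero_le _, ?_⟩ (fun k _ => ?_) (fun k _ hk => ?_) hA hin hexp,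
    exists_coeff_of_mahlerMeasure_dilate (hdeg n) (Real.exp_pos 1) _
    ⟨n, le_rfl, ?_⟩ (fun k hk => ?_) (fun k _ hk => ?_) hA hout hexp⟩
  · simp; positivity
  · rw [← Real.exp_nat_mul]
    gcongr
    simp
  · rw [← Real.exp_nat_mul, ← Real.exp_add]
    gcongr
    linarith [not_le.1 hk]
  · nlinarith [n.cast_nonneg (α := ℝ)]
  · rw [← Real.exp_nat_mul]
    gcongr
    rw [mul_one]
    exact_mod_cast hk
  · rw [← Real.exp_nat_mul, ← Real.exp_add]
    gcongr
    linarith [not_le.1 hk]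

/-! ### The equivalence -/

theorem mainTheorem3 (a : ℕ → ℕ → ℂ) (ha : ∀ n : ℕ, 1 ≤ n → rowPoly a n ≠ 0) :
    Tendsto (fun n : ℕ => empiricalMeasure n (rowPoly a n)) atTop
        (𝓝 uniformCircle.toFiniteMeasure) ↔
      ∀ ε : ℝ, 0 < ε → ∃ N : ℕ, ∀ n : ℕ, N < n →
        maxLogCoeff (a n) n 0 n - maxLogCoeff (a n) n 0 (ε * n) ≤ ((ε * n : ℝ) : EReal) ∧
        maxLogCoeff (a n) n 0 n - maxLogCoeff (a n) n ((1 - ε) * n) n ≤ ((ε * n : ℝ) : EReal) := by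
  have hdeg := natDegree_rowPoly_le a
  have hcoeff : ∀ n k, k ≤ n → (rowPoly a n).coeff k = a n k := fun n k hk => by
    rw [coeff_rowPoly, if_pos hk]
  have hmax : ∀ (n k : ℕ) (x : ℝ), k ≤ n →
      ((∀ j ≤ n, ‖a n j‖ ≤ x * ‖a n k‖) ↔
        maxNormCoeff (rowPoly a n) n ≤ x * ‖(rowPoly a n).coeff k‖) := by
    intro n k x hk
    rw [maxNormCoeff_le_iff, hcoeff n k hk]
    exact forall₂_congr fun j hj => by rw [hcoeff n j hj]
  have hlow : ∀ (n : ℕ) (ε : ℝ), 0 < ε →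
      (maxLogCoeff (a n) n 0 n - maxLogCoeff (a n) n 0 (ε * n) ≤ ((ε * n : ℝ) : EReal) ↔
        ∃ k ≤ n, (k : ℝ) ≤ ε * n ∧ maxNormCoeff (rowPoly a n) n ≤
          Real.exp (ε * n) * ‖(rowPoly a n).coeff k‖) := by
    intro n ε hε
    rw [maxLogCoeff_sub_le_iff _ _ _ _ _ ⟨0, Nat.zero_le _, by simp, by simp; positivity⟩]
    refine exists_congr fun k => and_congr_right fun hk => ?_
    rw [hmax n k _ hk]
    simp
  have hhigh : ∀ (n : ℕ) (ε : ℝ), 0 < ε →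
      (maxLogCoeff (a n) n 0 n - maxLogCoeff (a n) n ((1 - ε) * n) n ≤ ((ε * n : ℝ) : EReal) ↔
        ∃ k ≤ n, (1 - ε) * n ≤ (k : ℝ) ∧ maxNormCoeff (rowPoly a n) n ≤
          Real.exp (ε * n) * ‖(rowPoly a n).coeff k‖) := by
    intro n ε hε
    rw [maxLogCoeff_sub_le_iff _ _ _ _ _
      ⟨n, le_rfl, by nlinarith [n.cast_nonneg (α := ℝ)], le_rfl⟩]
    refine exists_congr fun k => and_congr_right fun hk => ?_
    rw [hmax n k _ hk]
    simp [hk]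
  constructor
  · intro h ε hε
    obtain ⟨N, hN⟩ := eventually_atTop.1 (eventually_coeff_conditions ha hdeg h hε)
    exact ⟨N, fun n hn => ⟨(hlow n ε hε).2 (hN n hn.le).1, (hhigh n ε hε).2 (hN n hn.le).2⟩⟩
  · intro h
    refine tendsto_empiricalMeasure_uniformCircle ha hdeg (fun ε hε => ?_) fun ε hε => ?_
    · obtain ⟨N, hN⟩ := h ε hε
      exact ⟨N, fun n hn => (hlow n ε hε).1 (hN n hn).1⟩
    · obtain ⟨N, hN⟩ := h ε hε
      exact ⟨N, fun n hn => (hhigh n ε hε).1 (hN n hn).2⟩
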